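/- Let $m=(m_0,m_1,\dots)$ be a bounded sequence of integers $m_k\ge 2$, let $G_m=\prod_{k\ge 0}\mathbb{Z}/m_k\mathbb{Z}$ be the corresponding (bounded) Vilenkin group, and let $\mu$ be its normalized Haar measure, i.e. the product of the uniform probability measures on the factors. Put $M_0=1$, $M_{k+1}=m_kM_k$, and write every $n\in\mathbb{N}$ uniquely as $n=\sum_{j\ge 0} n_jM_j$ with $0\le n_j<m_j$. For $x=(x_k)_k\in G_m$ with $x_k\in\{0,\dots,m_k-1\}$ let $r_k(x)=\exp(2\pi i x_k/m_k)$ and $\psi_n(x)=\prod_{k\ge 0} r_k(x)^{n_k}$. For $f\in L_1(G_m)$ (complex-valued) let $\widehat f(n)=\int_{G_m} f\,\overline{\psi_n}\,d\mu$, $S_nf=\sum_{k=0}^{n-1}\widehat f(k)\psi_k$, and $S_0f=0$. Let $1\le p\le\infty$ and $f\in L_p(G_m)$. Then, as $n\to\infty$, the following hold. 1. $R_nf\to f$ almost everywhere, where $$R_nf=\frac1{l_n}\sum_{k=1}^{n-1}\frac{S_kf}{k},\qquad l_n=\sum_{k=1}^{n-1}\frac1k .$$ 2. For every $0<\alpha<1$,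 $U_n^\alpha f\to f$ almost everywhere, where $$U_n^\alpha f=\frac1{A_n^\alpha}\sum_{k=0}^{n-1}A_k^{\alpha-1}S_kf,\qquad A_0^\beta=0,\quad A_n^\beta=\frac{(\beta+1)\cdots(\beta+n)}{n!}\ (n\ge 1).$$ 3. For every $0<\alpha<1$, $V_n^\alpha f\to f$ almost everywhere, where $$V_n^\alpha f=\frac1{Q_n}\sum_{k=1}^{n-1}k^{\alpha-1}S_kf,\qquad Q_n=\sum_{k=1}^{n-1}k^{\alpha-1}.$$ 4. For every $\alpha>0$, $B_n^\alpha f\to f$ almost everywhere, where $$B_n^\alpha f=\frac1{Q_n}\sum_{k=1}^{n}\log^\alpha(k+1)\,S_kf,\qquad Q_n=\sum_{k=0}^{n-1}\log^\alpha(k+1).$$ -/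

import Mathlib

open MeasureTheory Filter Topology
open scoped ENNReal ComplexConjugate

noncomputable section

namespace Vilenkin

/-- The Vilenkin group: the complete direct product of the cyclic groups `ℤ/m_kℤ`. -/
abbrev Group (m : ℕ → ℕ) : Type := ∀ k, ZMod (m k)

/-- The measure on `ℤ/m_kℤ` giving mass `1 / m_k` to every point. -/
def coordMeasure (m : ℕ → ℕ) (k : ℕ) : Measure (ZMod (m k)) :=
  (m k : ℝ≥0∞)⁻¹ • Measure.count

/-- The normalized Haar measure on the Vilenkin group, as the product of the coordinate measures. -/
def haar (m : ℕ → ℕ) : Measure (Group m) :=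
  Measure.infinitePi (coordMeasure m)

theorem isProbabilityMeasure_coordMeasure {m : ℕ → ℕ} (hm : ∀ k, 2 ≤ m k) (k : ℕ) :
    IsProbabilityMeasure (coordMeasure m k) := by
  have h0 : m k ≠ 0 := by have := hm k; omega
  haveI : NeZero (m k) := ⟨h0⟩
  constructor
  rw [coordMeasure, Measure.smul_apply, Measure.count_apply MeasurableSet.univ,
    Set.encard_univ, ENat.card_eq_coe_fintype_card, ZMod.card, smul_eq_mul]
  exact ENNReal.inv_mul_cancel (by simpa using h0) (by simp)

theorem isProbabilityMeasure_haar {m : ℕ → ℕ} (hm : ∀ k, 2 ≤ m k) :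
    IsProbabilityMeasure (haar m) := by
  haveI := isProbabilityMeasure_coordMeasure hm
  unfold haar
  infer_instance

/-- The generalized powers `M_0 = 1`, `M_{k+1} = m_k M_k`. -/
def M (m : ℕ → ℕ) (k : ℕ) : ℕ := ∏ j ∈ Finset.range k, m j

/-- The `k`-th digit `n_k` of `n` in the expansion `n = ∑ n_k M_k`, `0 ≤ n_k < m_k`. -/
def digit (m : ℕ → ℕ) (n k : ℕ) : ℕ := n / M m k % m k

/-- The generalized Rademacher functions `r_k(x) = exp(2πi x_k / m_k)`. -/
def rademacher (m : ℕ → ℕ) (k : ℕ) (x : Group m) : ℂ :=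
  Complex.exp (2 * Real.pi * Complex.I * ((x k).val : ℂ) / (m k : ℂ))

/-- The Vilenkin functions `ψ_n = ∏_k r_k ^ n_k`; only finitely many factors differ from `1`. -/
def psi (m : ℕ → ℕ) (n : ℕ) (x : Group m) : ℂ :=
  ∏ᶠ k : ℕ, rademacher m k x ^ digit m n k

/-- The Vilenkin–Fourier coefficients. -/
def coeff (m : ℕ → ℕ) (f : Group m → ℂ) (n : ℕ) : ℂ :=
  ∫ x, f x * conj (psi m n x) ∂(haar m)

/-- The partial sums `S_n f = ∑_{k<n} f̂(k) ψ_k`, with `S_0 f = 0`. -/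
def partialSum (m : ℕ → ℕ) (f : Group m → ℂ) (n : ℕ) (x : Group m) : ℂ :=
  ∑ k ∈ Finset.range n, coeff m f k * psi m k x

/-- `A_0^α = 0` and `A_n^α = (α+1)⋯(α+n)/n!` for `n ≥ 1`. -/
def cesaroNumber (α : ℝ) (n : ℕ) : ℝ :=
  if n = 0 then 0 else (∏ j ∈ Finset.Icc 1 n, (α + (j : ℝ))) / (n.factorial : ℝ)

/-- The Riesz logarithmic means `R_n f = l_n⁻¹ ∑_{k=1}^{n-1} S_k f / k`, where
`l_n = ∑_{k=1}^{n-1} 1/k`. -/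
def rieszMean (m : ℕ → ℕ) (f : Group m → ℂ) (n : ℕ) (x : Group m) : ℂ :=
  (∑ k ∈ Finset.Ico 1 n, partialSum m f k x / (k : ℂ)) /
    ((∑ k ∈ Finset.Ico 1 n, 1 / (k : ℝ) : ℝ) : ℂ)

/-- The inverse Cesàro means `U_n^α f = (A_n^α)⁻¹ ∑_{k=0}^{n-1} A_k^{α-1} S_k f`. -/
def inverseCesaroMean (m : ℕ → ℕ) (α : ℝ) (f : Group m → ℂ) (n : ℕ) (x : Group m) : ℂ :=
  (∑ k ∈ Finset.range n, (cesaroNumber (α - 1) k : ℂ) * partialSum m f k x) /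
    (cesaroNumber α n : ℂ)

/-- The means `V_n^α f = Q_n⁻¹ ∑_{k=1}^{n-1} k^{α-1} S_k f`, where
`Q_n = ∑_{k=1}^{n-1} k^{α-1}`. -/
def powerMean (m : ℕ → ℕ) (α : ℝ) (f : Group m → ℂ) (n : ℕ) (x : Group m) : ℂ :=
  (∑ k ∈ Finset.Ico 1 n, (((k : ℝ) ^ (α - 1) : ℝ) : ℂ) * partialSum m f k x) /
    ((∑ k ∈ Finset.Ico 1 n, (k : ℝ) ^ (α - 1) : ℝ) : ℂ)

/-- The means `B_n^α f = Q_n⁻¹ ∑_{k=1}^{n} log^α(k+1) S_k f`, where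
`Q_n = ∑_{k=0}^{n-1} log^α(k+1)`. -/
def logMean (m : ℕ → ℕ) (α : ℝ) (f : Group m → ℂ) (n : ℕ) (x : Group m) : ℂ :=
  (∑ k ∈ Finset.Icc 1 n, ((Real.log ((k : ℝ) + 1) ^ α : ℝ) : ℂ) * partialSum m f k x) /
    ((∑ k ∈ Finset.range n, Real.log ((k : ℝ) + 1) ^ α : ℝ) : ℂ)

end Vilenkin

end

/-!
All four families of means are weighted means of the partial sums `S_k f`, and they converge at
every point `x` where the Fejér means `(S_1 f + ⋯ + S_n f) / n` converge to `f x`: summation by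
parts rewrites them through the Fejér means, and for weights which are monotone with
`n q_n = O(q_0 + ⋯ + q_{n-1})` the resulting summation method is regular (`tendsto_weightedMean`).
Since `L_p ⊆ L_1` on a probability space, it remains to prove that the Fejér means of an integrable
function converge almost everywhere (`ae_tendsto_fejerMean`).

The kernel of `S_1 + ⋯ + S_n` depends on `x` and `y` only through the roots of unity
`u_k = r_k(x) * conj (r_k(y))`. Splitting off the leading digit of `n` gives a recursion for it, and
the factors `∑_{q < m_l} u_l ^ q` occurring there vanish unless `u_l = 1`. Hence for `n < M_A` the
kernel is at most a constant times `∑_{l < A} J_l`, where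
`J_l = ∑_{t ≤ l} M_t M_l 1{y_i = x_i for all i < l, i ≠ t}` (`norm_fejerSum_le`). As
`∑_{l ≤ A} M_l ≤ 2 M_A`, the Fejér means of `f` are dominated by the supremum over `l` of the
positive operators with kernels `J_l / M_l`, applied to `|f|`.

This supremum is of weak type `(1, 1)` (`mul_haar_exists_nearOperator_gt_le`). Let `τ` be the
first rank at which the average of `F = |f|` over the cylinder of a point exceeds `c`. By Doob's
inequality `τ < ∞` only on a set of measure at most `‖F‖₁ / c`. At a point `x` with `τ = ∞`,
consider the part of the kernel with parameters `l` and `t`. The points `y` with `τ(y) ≤ t` do not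
contribute, because `y` and `x` share their first `t` coordinates; those with `τ(y) > l`
contribute `O(c)` after summation over `t`; and those with `t < τ(y) ≤ l` contribute a function
whose integral, summed over all `t` and `l`, is at most a constant times `∫ F ∑_{l ≥ τ} ∑_{t < τ}
M_t / M_l ≤ 2 ∫ F`. This positive decomposition avoids any use of cancellation.

Finally, functions that are constant on cylinders of some rank are dense in `L_1` by Lévy's upward
theorem, and they coincide with their partial sums of large index, so the usual density argument
applies.
-/

open scoped NNReal

namespace Vilenkin

/-! ### Weighted means of a Cesàro summable sequence -/

/-- Summation by parts. -/
theorem sum_weight_mul_eq (q : ℕ → ℝ) (a : ℕ → ℂ) (n : ℕ) :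
    ∑ k ∈ Finset.range n, (q k : ℂ) * a k =
      q n * ∑ j ∈ Finset.range n, a j +
        ∑ k ∈ Finset.range n, ((q k - q (k + 1) : ℝ) : ℂ) * ∑ j ∈ Finset.range (k + 1), a j := by
  induction n with
  | zero => simp
  | succ n ih =>
    rw [Finset.sum_range_succ, ih, Finset.sum_range_succ (fun k => ((q k - q (k + 1) : ℝ) : ℂ) * _),
      Finset.sum_range_succ a n]
    push_cast
    ring

theorem sum_succ_mul_sub_eq (q : ℕ → ℝ) (n : ℕ) :
    ∑ k ∈ Finset.range n, (k + 1 : ℝ) * (q k - q (k + 1)) =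
      ∑ k ∈ Finset.range n, q k - n * q n := by
  induction n with
  | zero => simp
  | succ n ih =>
    rw [Finset.sum_range_succ, ih, Finset.sum_range_succ]
    push_cast
    ring

/-- A Toeplitz-type criterion: weighted means of a sequence with vanishing Cesàro means vanish as
soon as the weights satisfy the bounds `hC` and `hV`. -/
theorem isLittleO_sum_weight_mul {q : ℕ → ℝ} (hq : ∀ k, 0 ≤ q k)
    (hQ : Tendsto (fun n => ∑ k ∈ Finset.range n, q k) atTop atTop) {C : ℝ}
    (hC : ∀ n : ℕ, n * q n ≤ C * ∑ k ∈ Finset.range n, q k)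
    (hV : ∀ n : ℕ, ∑ k ∈ Finset.range n, (k + 1 : ℝ) * |q k - q (k + 1)|
      ≤ C * ∑ k ∈ Finset.range n, q k) {a : ℕ → ℂ}
    (ha : (fun n => ∑ k ∈ Finset.range n, a k) =o[atTop] fun n : ℕ => (n : ℝ)) :
    (fun n => ∑ k ∈ Finset.range n, (q k : ℂ) * a k) =o[atTop]
      fun n => ∑ k ∈ Finset.range n, q k := by
  have hQ0 : ∀ n, 0 ≤ ∑ k ∈ Finset.range n, q k := fun n => Finset.sum_nonneg fun k _ => hq k
  have h1 : (fun n : ℕ => (q n : ℂ) * ∑ j ∈ Finset.range n, a j) =o[atTop]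
      fun n => ∑ k ∈ Finset.range n, q k := by
    have : (fun n : ℕ => (q n : ℂ) * ∑ j ∈ Finset.range n, a j) =o[atTop]
        fun n : ℕ => q n * (n : ℝ) :=
      (Asymptotics.isBigO_of_le _ fun n => by simp).mul_isLittleO ha
    refine this.trans_isBigO (Asymptotics.IsBigO.of_bound C (Eventually.of_forall fun n => ?_))
    rw [Real.norm_of_nonneg (by have := hq n; positivity), Real.norm_of_nonneg (hQ0 n), mul_comm]
    exact hC n
  -- Adding `q k` to the majorant makes its partial sums diverge.
  have h2 : (fun n : ℕ => ∑ k ∈ Finset.range n,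
      ((q k - q (k + 1) : ℝ) : ℂ) * ∑ j ∈ Finset.range (k + 1), a j) =o[atTop]
      fun n => ∑ k ∈ Finset.range n, ((k + 1 : ℝ) * |q k - q (k + 1)| + q k) := by
    refine Asymptotics.IsLittleO.sum_range ?_ (fun k => ?_) ?_
    · have hs : (fun k : ℕ => ∑ j ∈ Finset.range (k + 1), a j) =o[atTop]
          fun k : ℕ => ((k + 1 : ℕ) : ℝ) := ha.comp_tendsto (tendsto_add_atTop_nat 1)
      have : (fun k : ℕ => ((q k - q (k + 1) : ℝ) : ℂ) * ∑ j ∈ Finset.range (k + 1), a j)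
          =o[atTop] fun k : ℕ => (q k - q (k + 1)) * ((k + 1 : ℕ) : ℝ) :=
        (Asymptotics.isBigO_of_le _ fun n => by
          rw [Complex.norm_real]).mul_isLittleO hs
      refine this.trans_isBigO (Asymptotics.isBigO_of_le _ fun k => ?_)
      have h0 : (0 : ℝ) ≤ (k + 1 : ℝ) * |q k - q (k + 1)| := by positivity
      rw [Real.norm_of_nonneg (add_nonneg h0 (hq k)), norm_mul, Real.norm_eq_abs,
        Real.norm_of_nonneg (by positivity)]
      push_cast
      linarith [hq k]
    · exact add_nonneg (by positivity) (hq k)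
    · refine tendsto_atTop_mono (fun n => Finset.sum_le_sum fun k _ => ?_) hQ
      exact le_add_of_nonneg_left (by positivity)
  have h3 : (fun n => ∑ k ∈ Finset.range n, ((k + 1 : ℝ) * |q k - q (k + 1)| + q k)) =O[atTop]
      fun n => ∑ k ∈ Finset.range n, q k := by
    refine Asymptotics.IsBigO.of_bound (C + 1) (Eventually.of_forall fun n => ?_)
    rw [Real.norm_of_nonneg, Real.norm_of_nonneg (hQ0 n), Finset.sum_add_distrib]
    · linarith [hV n]
    · exact Finset.sum_nonneg fun k _ => add_nonneg (by positivity) (hq k)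
  exact (h1.add (h2.trans_isBigO h3)).congr_left fun n => (sum_weight_mul_eq q a n).symm

theorem tendsto_weightedMean {q : ℕ → ℝ} (hq : ∀ k, 0 ≤ q k)
    (hQ : Tendsto (fun n => ∑ k ∈ Finset.range n, q k) atTop atTop) {C : ℝ}
    (hC : ∀ n : ℕ, n * q n ≤ C * ∑ k ∈ Finset.range n, q k)
    (hV : ∀ n : ℕ, ∑ k ∈ Finset.range n, (k + 1 : ℝ) * |q k - q (k + 1)|
      ≤ C * ∑ k ∈ Finset.range n, q k) {a : ℕ → ℂ} {L : ℂ}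
    (ha : Tendsto (fun n : ℕ => (∑ k ∈ Finset.range n, a k) / (n : ℂ)) atTop (𝓝 L)) :
    Tendsto (fun n => (∑ k ∈ Finset.range n, (q k : ℂ) * a k) /
      ((∑ k ∈ Finset.range n, q k : ℝ) : ℂ)) atTop (𝓝 L) := by
  have ha' : (fun n => ∑ k ∈ Finset.range n, (a k - L)) =o[atTop] fun n : ℕ => (n : ℝ) := by
    rw [← Asymptotics.isLittleO_norm_right]
    simp only [Real.norm_natCast]
    have : (fun n => ∑ k ∈ Finset.range n, (a k - L)) =o[atTop] fun n : ℕ => (n : ℂ) := by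
      rw [Asymptotics.isLittleO_iff_tendsto']
      · have := ha.sub_const L
        rw [sub_self] at this
        refine this.congr' ?_
        filter_upwards [eventually_ne_atTop 0] with n hn
        have : (n : ℂ) ≠ 0 := by exact_mod_cast hn
        simp only [Finset.sum_sub_distrib, Finset.sum_const, Finset.card_range, nsmul_eq_mul]
        field_simp
      · filter_upwards [eventually_ne_atTop 0] with n hn h
        exact absurd h (by exact_mod_cast hn)
    refine this.trans_isBigO (Asymptotics.isBigO_of_le _ fun n => by simp)
  have h := isLittleO_sum_weight_mul hq hQ hC hV ha'
  have h' : (fun n => ∑ k ∈ Finset.range n, (q k : ℂ) * (a k - L)) =o[atTop]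
      fun n => ((∑ k ∈ Finset.range n, q k : ℝ) : ℂ) :=
    h.trans_isBigO (Asymptotics.isBigO_of_le _ fun n => by rw [Complex.norm_real])
  have h2 := (h'.tendsto_div_nhds_zero).add_const L
  rw [zero_add] at h2
  refine h2.congr' ?_
  filter_upwards [hQ.eventually_gt_atTop 0] with n hn
  have : ((∑ k ∈ Finset.range n, q k : ℝ) : ℂ) ≠ 0 := by exact_mod_cast hn.ne'
  simp only [mul_sub, Finset.sum_sub_distrib, ← Finset.sum_mul]
  rw [div_add' _ _ _ this]
  push_cast
  ring_nf

theorem tendsto_weightedMean_of_antitone {q : ℕ → ℝ} (hq : ∀ k, 0 ≤ q k) (hanti : Antitone q)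
    (hQ : Tendsto (fun n => ∑ k ∈ Finset.range n, q k) atTop atTop) {a : ℕ → ℂ} {L : ℂ}
    (ha : Tendsto (fun n : ℕ => (∑ k ∈ Finset.range n, a k) / (n : ℂ)) atTop (𝓝 L)) :
    Tendsto (fun n => (∑ k ∈ Finset.range n, (q k : ℂ) * a k) /
      ((∑ k ∈ Finset.range n, q k : ℝ) : ℂ)) atTop (𝓝 L) := by
  refine tendsto_weightedMean (C := 1) hq hQ (fun n => ?_) (fun n => ?_) ha
  · have := Finset.card_nsmul_le_sum (Finset.range n) q (q n)
      fun k hk => hanti (Finset.mem_range.1 hk).le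
    simpa using this
  · have h : ∀ k, |q k - q (k + 1)| = q k - q (k + 1) := fun k =>
      abs_of_nonneg (sub_nonneg.2 (hanti k.le_succ))
    simp_rw [h, sum_succ_mul_sub_eq]
    have := hq n
    have : (0 : ℝ) ≤ n * q n := by positivity
    linarith

theorem tendsto_weightedMean_of_monotone {q : ℕ → ℝ} (hq : ∀ k, 0 ≤ q k) (hmono : Monotone q)
    (hQ : Tendsto (fun n => ∑ k ∈ Finset.range n, q k) atTop atTop) {C : ℝ}
    (hC : ∀ n : ℕ, n * q n ≤ C * ∑ k ∈ Finset.range n, q k) {a : ℕ → ℂ} {L : ℂ}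
    (ha : Tendsto (fun n : ℕ => (∑ k ∈ Finset.range n, a k) / (n : ℂ)) atTop (𝓝 L)) :
    Tendsto (fun n => (∑ k ∈ Finset.range n, (q k : ℂ) * a k) /
      ((∑ k ∈ Finset.range n, q k : ℝ) : ℂ)) atTop (𝓝 L) := by
  refine tendsto_weightedMean hq hQ hC (fun n => ?_) ha
  have h : ∀ k, |q k - q (k + 1)| = -(q k - q (k + 1)) := fun k =>
    abs_of_nonpos (sub_nonpos.2 (hmono k.le_succ))
  simp_rw [h, mul_neg, Finset.sum_neg_distrib, sum_succ_mul_sub_eq]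
  have := Finset.sum_nonneg fun k (_ : k ∈ Finset.range n) => hq k
  linarith [hC n]

/-! ### The four families of weights -/

section Weights

variable {S : ℕ → ℂ} {L : ℂ}

/-- A sum over `1 ≤ k < n + 1` is a sum over `k < n` after a shift. -/
theorem sum_Ico_one_eq {E : Type*} [AddCommMonoid E] (g : ℕ → E) (n : ℕ) :
    ∑ k ∈ Finset.Ico 1 (n + 1), g k = ∑ k ∈ Finset.range n, g (k + 1) := by
  rw [Finset.sum_Ico_eq_sum_range]
  simp [add_comm]

theorem tendsto_weightedMean_Ico {q : ℕ → ℝ} (hq : ∀ k, 0 ≤ q (k + 1))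
    (hanti : Antitone fun k => q (k + 1))
    (hQ : Tendsto (fun n => ∑ k ∈ Finset.range n, q (k + 1)) atTop atTop)
    (hS : Tendsto (fun n : ℕ => (∑ k ∈ Finset.range n, S (k + 1)) / (n : ℂ)) atTop (𝓝 L)) :
    Tendsto (fun n => (∑ k ∈ Finset.Ico 1 n, (q k : ℂ) * S k) /
      ((∑ k ∈ Finset.Ico 1 n, q k : ℝ) : ℂ)) atTop (𝓝 L) := by
  rw [← tendsto_add_atTop_iff_nat 1]
  simp_rw [sum_Ico_one_eq]
  exact tendsto_weightedMean_of_antitone (q := fun k => q (k + 1)) hq hanti hQ hS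

theorem tendsto_sum_one_div_succ :
    Tendsto (fun n => ∑ k ∈ Finset.range n, 1 / ((k + 1 : ℕ) : ℝ)) atTop atTop := by
  simpa using Real.tendsto_sum_range_one_div_nat_succ_atTop

theorem tendsto_riesz
    (hS : Tendsto (fun n : ℕ => (∑ k ∈ Finset.range n, S (k + 1)) / (n : ℂ)) atTop (𝓝 L)) :
    Tendsto (fun n => (∑ k ∈ Finset.Ico 1 n, S k / (k : ℂ)) /
      ((∑ k ∈ Finset.Ico 1 n, 1 / (k : ℝ) : ℝ) : ℂ)) atTop (𝓝 L) := by
  have := tendsto_weightedMean_Ico (q := fun k => 1 / (k : ℝ)) (fun k => by positivity)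
    (fun i j hij => one_div_le_one_div_of_le (by positivity) (by exact_mod_cast by omega))
    tendsto_sum_one_div_succ hS
  refine this.congr fun n => ?_
  congr 1
  refine Finset.sum_congr rfl fun k _ => ?_
  push_cast
  ring

theorem tendsto_power {α : ℝ} (h0 : 0 < α) (h1 : α < 1)
    (hS : Tendsto (fun n : ℕ => (∑ k ∈ Finset.range n, S (k + 1)) / (n : ℂ)) atTop (𝓝 L)) :
    Tendsto (fun n : ℕ => (∑ k ∈ Finset.Ico 1 n, (((k : ℝ) ^ (α - 1) : ℝ) : ℂ) * S k) /
      ((∑ k ∈ Finset.Ico 1 n, (k : ℝ) ^ (α - 1) : ℝ) : ℂ)) atTop (𝓝 L) := by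
  refine tendsto_weightedMean_Ico (q := fun k => (k : ℝ) ^ (α - 1)) (fun k => by positivity)
    (fun i j hij => ?_) ?_ hS
  · exact Real.rpow_le_rpow_of_nonpos (by positivity) (by exact_mod_cast by omega) (by linarith)
  · refine tendsto_atTop_mono (fun n => Finset.sum_le_sum fun k _ => ?_) tendsto_sum_one_div_succ
    rw [one_div, ← Real.rpow_neg_one]
    exact Real.rpow_le_rpow_of_exponent_le (by simp) (by linarith)

theorem cesaroNumber_succ {α : ℝ} {n : ℕ} (hn : n ≠ 0) :
    cesaroNumber α (n + 1) = cesaroNumber α n * ((α + (n + 1)) / (n + 1)) := by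
  rw [cesaroNumber, cesaroNumber, if_neg (by omega), if_neg hn,
    Finset.prod_Icc_succ_top (by omega), Nat.factorial_succ]
  have : (n.factorial : ℝ) ≠ 0 := by positivity
  push_cast
  field_simp

theorem cesaroNumber_one (α : ℝ) : cesaroNumber α 1 = α + 1 := by simp [cesaroNumber]

theorem cesaroNumber_pos {α : ℝ} (hα : -1 < α) (n : ℕ) : 0 < cesaroNumber α (n + 1) := by
  induction n with
  | zero => rw [cesaroNumber_one]; linarith
  | succ n ih =>
    rw [cesaroNumber_succ (n := n + 1) (by omega)]
    push_cast
    have : (0 : ℝ) ≤ n := by positivity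
    exact mul_pos ih (div_pos (by linarith) (by linarith))

/-- The hockey-stick identity `∑_{k ≤ n} A_k^{α-1} = A_n^α`; the `- 1` accounts for the convention
`A_0^{α-1} = 0`. -/
theorem sum_cesaroNumber (α : ℝ) (n : ℕ) :
    ∑ k ∈ Finset.range (n + 1), cesaroNumber (α - 1) (k + 1) = cesaroNumber α (n + 1) - 1 := by
  -- This is `α * A_n^α = (α + n) * A_n^{α-1}`, with `n + 1` in place of `n`.
  have key : ∀ n : ℕ, α * cesaroNumber α (n + 1) =
      cesaroNumber (α - 1) (n + 1) * (α + (n + 1)) := by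
    intro n
    induction n with
    | zero => rw [cesaroNumber_one, cesaroNumber_one]; push_cast; ring
    | succ n ih =>
      rw [cesaroNumber_succ (n := n + 1) (by omega),
        cesaroNumber_succ (α := α - 1) (n := n + 1) (by omega), ← mul_assoc, ih]
      push_cast
      have : (n : ℝ) + 1 + 1 ≠ 0 := by positivity
      field_simp
      ring
  induction n with
  | zero => rw [Finset.sum_range_one, cesaroNumber_one, cesaroNumber_one]; ring
  | succ n ih =>
    rw [Finset.sum_range_succ, ih, cesaroNumber_succ (α := α) (n := n + 1) (by omega),
      cesaroNumber_succ (α := α - 1) (n := n + 1) (by omega)]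
    have := key n
    push_cast
    have h : (n : ℝ) + 1 + 1 ≠ 0 := by positivity
    field_simp
    linear_combination -this

theorem tendsto_sum_cesaroNumber {α : ℝ} (h0 : 0 < α) :
    Tendsto (fun n => ∑ k ∈ Finset.range n, cesaroNumber (α - 1) (k + 1)) atTop atTop := by
  have h : ∀ n : ℕ, α * (1 / ((n + 1 : ℕ) : ℝ)) ≤ cesaroNumber (α - 1) (n + 1) := by
    intro n
    induction n with
    | zero => rw [cesaroNumber_one]; simp
    | succ n ih =>
      rw [cesaroNumber_succ (n := n + 1) (by omega)]
      have h1 : α * (1 / ((n + 1 + 1 : ℕ) : ℝ)) =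
          α * (1 / ((n + 1 : ℕ) : ℝ)) * (((n + 1 : ℕ) : ℝ) / (((n + 1 : ℕ) : ℝ) + 1)) := by
        push_cast
        field_simp
      rw [h1]
      have h2 : (((n + 1 : ℕ) : ℝ) / (((n + 1 : ℕ) : ℝ) + 1)) ≤
          (α - 1 + (((n + 1 : ℕ) : ℝ) + 1)) / (((n + 1 : ℕ) : ℝ) + 1) := by
        gcongr
        linarith
      exact mul_le_mul ih h2 (by positivity) (cesaroNumber_pos (by linarith) n).le
  refine tendsto_atTop_mono (fun n => ?_) (tendsto_sum_one_div_succ.const_mul_atTop h0)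
  rw [Finset.mul_sum]
  exact Finset.sum_le_sum fun k _ => h k

theorem tendsto_inverseCesaro {α : ℝ} (h0 : 0 < α) (h1 : α < 1)
    (hS : Tendsto (fun n : ℕ => (∑ k ∈ Finset.range n, S (k + 1)) / (n : ℂ)) atTop (𝓝 L)) :
    Tendsto (fun n => (∑ k ∈ Finset.range n, (cesaroNumber (α - 1) k : ℂ) * S k) /
      (cesaroNumber α n : ℂ)) atTop (𝓝 L) := by
  have hQ := tendsto_sum_cesaroNumber h0
  have hmean := tendsto_weightedMean_of_antitone (q := fun k => cesaroNumber (α - 1) (k + 1))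
    (fun k => (cesaroNumber_pos (by linarith) k).le) (antitone_nat_of_succ_le fun k => by
      rw [cesaroNumber_succ (n := k + 1) (by omega)]
      refine mul_le_of_le_one_right (cesaroNumber_pos (by linarith) k).le ?_
      rw [div_le_one (by positivity)]
      linarith) hQ hS
  have hratio : Tendsto (fun n : ℕ =>
      (∑ k ∈ Finset.range (n + 1), cesaroNumber (α - 1) (k + 1)) / cesaroNumber α (n + 1 + 1))
      atTop (𝓝 1) := by
    have hA : Tendsto (fun n => cesaroNumber α (n + 1)) atTop atTop := by
      have := tendsto_atTop_add_const_right _ (1 : ℝ) (hQ.comp (tendsto_add_atTop_nat 1))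
      refine this.congr fun n => ?_
      simp only [Function.comp_apply]
      rw [sum_cesaroNumber]
      ring
    have h2 : Tendsto (fun n : ℕ => (1 + α / (((n + 1 : ℕ) : ℝ) + 1))⁻¹) atTop (𝓝 1) := by
      have h3 : Tendsto (fun n : ℕ => α / (((n + 1 : ℕ) : ℝ) + 1)) atTop (𝓝 0) := by
        refine tendsto_const_nhds.div_atTop ?_
        exact tendsto_atTop_add_const_right _ _
          (tendsto_natCast_atTop_atTop.comp (tendsto_add_atTop_nat 1))
      simpa using (h3.const_add 1).inv₀ (by simp)
    have h4 := h2.sub (tendsto_inv_atTop_zero.comp (hA.comp (tendsto_add_atTop_nat 1)))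
    rw [sub_zero] at h4
    refine h4.congr fun n => ?_
    simp only [Function.comp_apply]
    have hp := cesaroNumber_pos (α := α) (by linarith) n
    have hpos : (0 : ℝ) < α + (((n + 1 : ℕ) : ℝ) + 1) := by positivity
    rw [sum_cesaroNumber, sub_div, one_div]
    congr 1
    rw [cesaroNumber_succ (n := n + 1) (by omega)]
    field_simp
    ring
  rw [← tendsto_add_atTop_iff_nat 2]
  have hlim := (hmean.comp (tendsto_add_atTop_nat 1)).mul
    ((Complex.continuous_ofReal.tendsto 1).comp hratio)
  rw [Complex.ofReal_one, mul_one] at hlim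
  refine hlim.congr fun n => ?_
  simp only [Function.comp_apply]
  have hne : ((∑ k ∈ Finset.range (n + 1), cesaroNumber (α - 1) (k + 1) : ℝ) : ℂ) ≠ 0 := by
    refine Complex.ofReal_ne_zero.2 (Finset.sum_pos (fun k _ => ?_) (by simp)).ne'
    exact cesaroNumber_pos (by linarith) k
  rw [Complex.ofReal_div, div_mul_div_cancel₀ hne, Finset.sum_range_succ' _ (n + 1)]
  simp [cesaroNumber]

theorem tendsto_log {α : ℝ} (h0 : 0 < α)
    (hS : Tendsto (fun n : ℕ => (∑ k ∈ Finset.range n, S (k + 1)) / (n : ℂ)) atTop (𝓝 L)) :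
    Tendsto (fun n : ℕ => (∑ k ∈ Finset.Icc 1 n, ((Real.log ((k : ℝ) + 1) ^ α : ℝ) : ℂ) * S k) /
      ((∑ k ∈ Finset.range n, Real.log ((k : ℝ) + 1) ^ α : ℝ) : ℂ)) atTop (𝓝 L) := by
  set q : ℕ → ℝ := fun k => Real.log (((k + 1 : ℕ) : ℝ) + 1) ^ α with hqdef
  have hlog : ∀ k : ℕ, 0 < Real.log (((k + 1 : ℕ) : ℝ) + 1) := fun k =>
    Real.log_pos (by push_cast; linarith [(Nat.cast_nonneg k : (0 : ℝ) ≤ k)])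
  have hqpos : ∀ k, 0 < q k := fun k => Real.rpow_pos_of_pos (hlog k) _
  have hmono : Monotone q := fun i j hij => by
    refine Real.rpow_le_rpow (hlog i).le (Real.log_le_log (by positivity) ?_) h0.le
    exact_mod_cast by omega
  -- At least half of the indices `k < n` satisfy `log (n + 2) ≤ 2 log (k + 2)`.
  have hC : ∀ n : ℕ, n * q n ≤ (2 * 2 ^ α) * ∑ k ∈ Finset.range n, q k := by
    intro n
    have hk : ∀ k ∈ Finset.Ico (n / 2) n, q n ≤ 2 ^ α * q k := by
      intro k hk
      have hk' : n ≤ 2 * k + 1 := by have := (Finset.mem_Ico.1 hk).1; omega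
      have hk'' : (n : ℝ) ≤ 2 * k + 1 := by exact_mod_cast hk'
      rw [hqdef, ← Real.mul_rpow (by norm_num) (hlog k).le]
      refine Real.rpow_le_rpow (hlog n).le ?_ h0.le
      have hsq : 2 * Real.log (((k + 1 : ℕ) : ℝ) + 1) =
          Real.log ((((k + 1 : ℕ) : ℝ) + 1) ^ 2) := by
        rw [Real.log_pow]
        norm_num
      rw [hsq]
      refine Real.log_le_log (by positivity) ?_
      push_cast
      nlinarith [(Nat.cast_nonneg k : (0 : ℝ) ≤ k)]
    have h1 := Finset.card_nsmul_le_sum _ _ _ hk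
    rw [Nat.card_Ico, nsmul_eq_mul, ← Finset.mul_sum] at h1
    have h2 : ∑ k ∈ Finset.Ico (n / 2) n, q k ≤ ∑ k ∈ Finset.range n, q k :=
      Finset.sum_le_sum_of_subset_of_nonneg (fun k hk => by simp_all)
        fun k _ _ => (hqpos k).le
    have h3 : (n : ℝ) ≤ 2 * ((n - n / 2 : ℕ) : ℝ) := by exact_mod_cast by omega
    have h4 : (0 : ℝ) < 2 ^ α := by positivity
    calc (n : ℝ) * q n ≤ 2 * ((n - n / 2 : ℕ) : ℝ) * q n :=
          mul_le_mul_of_nonneg_right h3 (hqpos n).le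
      _ ≤ 2 * (2 ^ α * ∑ k ∈ Finset.Ico (n / 2) n, q k) := by linarith
      _ ≤ 2 * (2 ^ α * ∑ k ∈ Finset.range n, q k) := by gcongr
      _ = _ := by ring
  have hQ : Tendsto (fun n => ∑ k ∈ Finset.range n, q k) atTop atTop := by
    have h : Tendsto (fun n : ℕ => (n : ℝ) * q 0) atTop atTop :=
      tendsto_natCast_atTop_atTop.atTop_mul_const (hqpos 0)
    refine tendsto_atTop_mono (fun n => ?_) h
    have := Finset.card_nsmul_le_sum (Finset.range n) q (q 0) fun k _ => hmono k.zero_le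
    simpa using this
  have hmean := tendsto_weightedMean_of_monotone (fun k => (hqpos k).le) hmono hQ hC hS
  -- The normalizing sum omits the last weight, which is negligible.
  have hratio : Tendsto (fun n : ℕ => (∑ k ∈ Finset.range (n + 1), q k) /
      (∑ k ∈ Finset.range (n + 1), Real.log ((k : ℝ) + 1) ^ α)) atTop (𝓝 1) := by
    have hD : ∀ n, ∑ k ∈ Finset.range (n + 1), Real.log ((k : ℝ) + 1) ^ α =
        ∑ k ∈ Finset.range n, q k := fun n => by
      rw [Finset.sum_range_succ']
      simp [hqdef, Real.zero_rpow h0.ne']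
    simp_rw [hD]
    have h1 : Tendsto (fun n : ℕ => q n / ∑ k ∈ Finset.range n, q k) atTop (𝓝 0) := by
      have h2 : Tendsto (fun n : ℕ => (2 * 2 ^ α : ℝ) / (n : ℝ)) atTop (𝓝 0) :=
        tendsto_const_nhds.div_atTop tendsto_natCast_atTop_atTop
      refine squeeze_zero' (Eventually.of_forall fun n => ?_) ?_ h2
      · exact div_nonneg (hqpos n).le (Finset.sum_nonneg fun k _ => (hqpos k).le)
      · filter_upwards [hQ.eventually_gt_atTop 0, eventually_gt_atTop 0] with n hn hn0
        rw [div_le_div_iff₀ hn (by exact_mod_cast hn0), mul_comm]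
        exact hC n
    have h3 := h1.const_add 1
    rw [add_zero] at h3
    refine h3.congr' ?_
    filter_upwards [hQ.eventually_gt_atTop 0] with n hn
    rw [Finset.sum_range_succ, add_div, div_self hn.ne']
  rw [← tendsto_add_atTop_iff_nat 1]
  have hlim := (hmean.comp (tendsto_add_atTop_nat 1)).mul
    ((Complex.continuous_ofReal.tendsto 1).comp hratio)
  rw [Complex.ofReal_one, mul_one] at hlim
  refine hlim.congr fun n => ?_
  simp only [Function.comp_apply]
  have hne : ((∑ k ∈ Finset.range (n + 1), q k : ℝ) : ℂ) ≠ 0 :=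
    Complex.ofReal_ne_zero.2 (Finset.sum_pos (fun k _ => hqpos k) (by simp)).ne'
  have hIcc : Finset.Icc 1 (n + 1) = Finset.Ico 1 (n + 1 + 1) := rfl
  rw [Complex.ofReal_div, div_mul_div_cancel₀ hne, hIcc, sum_Ico_one_eq]

end Weights

/-! ### Digits -/

theorem M_succ (m : ℕ → ℕ) (k : ℕ) : M m (k + 1) = M m k * m k := Finset.prod_range_succ _ _

section Digits

variable {m : ℕ → ℕ} (hm : ∀ k, 2 ≤ m k)

include hm

theorem M_pos (k : ℕ) : 0 < M m k := Finset.prod_pos fun i _ => by have := hm i; omega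

theorem two_mul_M_le (k : ℕ) : 2 * M m k ≤ M m (k + 1) := by
  rw [M_succ, mul_comm]
  exact Nat.mul_le_mul_left _ (hm k)

theorem M_strictMono : StrictMono (M m) := strictMono_nat_of_lt_succ fun k => by
  have := two_mul_M_le hm k
  have := M_pos hm k
  omega

theorem digit_eq_zero {n A k : ℕ} (hn : n < M m A) (hk : A ≤ k) : digit m n k = 0 := by
  rw [digit, Nat.div_eq_of_lt (hn.trans_le ((M_strictMono hm).monotone hk)), Nat.zero_mod]

theorem digit_add_of_lt (s j : ℕ) {A k : ℕ} (hk : k < A) :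
    digit m (s * M m A + j) k = digit m j k := by
  obtain ⟨d, hd⟩ : M m (k + 1) ∣ M m A :=
    Finset.prod_dvd_prod_of_subset _ _ _ (Finset.range_mono hk)
  rw [digit, digit, hd, M_succ,
    show s * (M m k * m k * d) + j = M m k * (m k * (s * d)) + j by ring,
    Nat.mul_add_div (M_pos hm k), Nat.mul_add_mod]

theorem digit_add_self {s j A : ℕ} (hs : s < m A) (hj : j < M m A) :
    digit m (s * M m A + j) A = s := by
  rw [digit, mul_comm, Nat.mul_add_div (M_pos hm A), Nat.div_eq_of_lt hj, add_zero,
    Nat.mod_eq_of_lt hs]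

omit hm in
theorem mul_M_add_lt {s j A : ℕ} (hs : s < m A) (hj : j < M m A) :
    s * M m A + j < M m (A + 1) := by
  rw [M_succ]
  calc s * M m A + j < s * M m A + M m A := by omega
    _ = M m A * (s + 1) := by ring
    _ ≤ _ := Nat.mul_le_mul_left _ hs

end Digits

/-! ### Dirichlet and Fejér kernels -/

/-- The character `∏_k u_k ^ n_k` of index `n` evaluated at a sequence `u` of roots of unity. For
`u_k = r_k(x) * conj (r_k(y))` this is `ψ_n(x) * conj (ψ_n(y))`. -/
noncomputable def rootChar (m : ℕ → ℕ) (u : ℕ → ℂ) (n : ℕ) : ℂ := ∏ᶠ k : ℕ, u k ^ digit m n k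

/-- The Dirichlet kernel `D_n = ∑_{j < n} w_j`, with `w_j` the characters `rootChar`. -/
noncomputable def dirichletKernel (m : ℕ → ℕ) (u : ℕ → ℂ) (n : ℕ) : ℂ :=
  ∑ j ∈ Finset.range n, rootChar m u j

/-- The Fejér kernel without its normalizing factor: `D_1 + ⋯ + D_n`. -/
noncomputable def fejerSum (m : ℕ → ℕ) (u : ℕ → ℂ) (n : ℕ) : ℂ :=
  ∑ j ∈ Finset.range n, dirichletKernel m u (j + 1)

open Classical in
/-- The indicator that `u_i = 1` for all `i < l`, except possibly for `i = t`. -/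
noncomputable def nearOne (u : ℕ → ℂ) (l t : ℕ) : ℝ :=
  if ∀ i < l, i ≠ t → u i = 1 then 1 else 0

/-- The majorant `J_l = ∑_{t ≤ l} M_t M_l 1{u_i = 1 for i < l, i ≠ t}` of the Fejér kernel. -/
noncomputable def majorant (m : ℕ → ℕ) (u : ℕ → ℂ) (l : ℕ) : ℝ :=
  ∑ t ∈ Finset.range (l + 1), (M m t : ℝ) * M m l * nearOne u l t

theorem nearOne_nonneg (u : ℕ → ℂ) (l t : ℕ) : 0 ≤ nearOne u l t := by
  unfold nearOne
  split_ifs <;> norm_num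

theorem nearOne_succ_of_eq {u : ℕ → ℂ} {l : ℕ} (h : u l = 1) (t : ℕ) :
    nearOne u (l + 1) t = nearOne u l t := by
  unfold nearOne
  congr 1
  refine propext ⟨fun H i hi => H i (by omega), fun H i hi hit => ?_⟩
  rcases Nat.lt_succ_iff_lt_or_eq.1 hi with hi | rfl
  · exact H i hi hit
  · exact h

theorem nearOne_self_eq_of_le {u : ℕ → ℂ} {l t : ℕ} (h : l ≤ t) :
    nearOne u l t = nearOne u l l := by
  unfold nearOne
  congr 1
  exact propext ⟨fun H i hi _ => H i hi (by omega), fun H i hi _ => H i hi (by omega)⟩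

theorem nearOne_succ_self (u : ℕ → ℂ) (l : ℕ) : nearOne u (l + 1) l = nearOne u l l := by
  unfold nearOne
  congr 1
  exact propext ⟨fun H i hi h => H i (by omega) h, fun H i hi h => H i (by omega) h⟩

theorem nearOne_succ_succ_of_ne {u : ℕ → ℂ} {l : ℕ} (h : u l ≠ 1) :
    nearOne u (l + 1) (l + 1) = 0 := by
  unfold nearOne
  exact if_neg fun H => h (H l (by omega) (by omega))

theorem geom_sum_rootOfUnity {z : ℂ} {d : ℕ} (hz : z ^ d = 1) (h : z ≠ 1) :
    ∑ s ∈ Finset.range d, z ^ s = 0 := by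
  have := geom_sum_mul z d
  rw [hz, sub_self] at this
  exact (mul_eq_zero.1 this).resolve_right (sub_ne_zero.2 h)

section Kernels

variable {m : ℕ → ℕ} (hm : ∀ k, 2 ≤ m k) (u : ℕ → ℂ)

include hm

theorem rootChar_eq_prod {n A : ℕ} (hn : n < M m A) :
    rootChar m u n = ∏ k ∈ Finset.range A, u k ^ digit m n k := by
  refine finprod_eq_prod_of_mulSupport_subset _ fun k hk => ?_
  rw [Finset.coe_range, Set.mem_Iio]
  by_contra h
  exact hk (by simp only [digit_eq_zero hm hn (not_lt.1 h), pow_zero])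

theorem rootChar_add {s j A : ℕ} (hs : s < m A) (hj : j < M m A) :
    rootChar m u (s * M m A + j) = u A ^ s * rootChar m u j := by
  rw [rootChar_eq_prod hm u (mul_M_add_lt hs hj), rootChar_eq_prod hm u hj,
    Finset.prod_range_succ, digit_add_self hm hs hj, mul_comm]
  congr 1
  exact Finset.prod_congr rfl fun k hk => by rw [digit_add_of_lt hm s j (Finset.mem_range.1 hk)]

theorem dirichletKernel_add {s j A : ℕ} (hs : s < m A) (hj : j ≤ M m A) :
    dirichletKernel m u (s * M m A + j) =
      dirichletKernel m u (s * M m A) + u A ^ s * dirichletKernel m u j := by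
  simp only [dirichletKernel]
  rw [Finset.sum_range_add, Finset.mul_sum]
  congr 1
  exact Finset.sum_congr rfl fun k hk =>
    rootChar_add hm u hs ((Finset.mem_range.1 hk).trans_le hj)

theorem fejerSum_add {s j A : ℕ} (hs : s < m A) (hj : j ≤ M m A) :
    fejerSum m u (s * M m A + j) =
      fejerSum m u (s * M m A) + j * dirichletKernel m u (s * M m A) +
        u A ^ s * fejerSum m u j := by
  have h : ∀ k ∈ Finset.range j, dirichletKernel m u (s * M m A + k + 1) =
      dirichletKernel m u (s * M m A) + u A ^ s * dirichletKernel m u (k + 1) := fun k hk => by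
    have := Finset.mem_range.1 hk
    rw [add_assoc, dirichletKernel_add hm u hs (by omega)]
  simp only [fejerSum]
  rw [Finset.sum_range_add, Finset.sum_congr rfl h, Finset.sum_add_distrib, ← Finset.mul_sum]
  simp [add_assoc]

theorem dirichletKernel_mul {s A : ℕ} (hs : s ≤ m A) :
    dirichletKernel m u (s * M m A) =
      (∑ q ∈ Finset.range s, u A ^ q) * dirichletKernel m u (M m A) := by
  induction s with
  | zero => simp [dirichletKernel]
  | succ s ih =>
    rw [add_mul, one_mul, dirichletKernel_add hm u (by omega) le_rfl, ih (by omega),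
      Finset.sum_range_succ, add_mul]

theorem fejerSum_mul {s A : ℕ} (hs : s ≤ m A) :
    fejerSum m u (s * M m A) = ∑ q ∈ Finset.range s,
      (M m A * dirichletKernel m u (q * M m A) + u A ^ q * fejerSum m u (M m A)) := by
  induction s with
  | zero => simp [fejerSum]
  | succ s ih =>
    rw [add_mul, one_mul, fejerSum_add hm u (by omega) le_rfl, ih (by omega),
      Finset.sum_range_succ]
    ring

theorem rootChar_zero : rootChar m u 0 = 1 := by
  rw [rootChar_eq_prod hm u (M_pos hm 0), Finset.range_zero, Finset.prod_empty]

variable {u} (hu : ∀ k, u k ^ m k = 1)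

include hu

/-- `D_{M_l}` is `M_l` times the indicator that `u_i = 1` for all `i < l`. -/
theorem dirichletKernel_M (l : ℕ) : dirichletKernel m u (M m l) = M m l * (nearOne u l l : ℂ) := by
  induction l with
  | zero => simp [dirichletKernel, M, rootChar_zero hm, nearOne]
  | succ l ih =>
    rw [M_succ, mul_comm, dirichletKernel_mul hm u le_rfl, ih]
    by_cases h : u l = 1
    · rw [nearOne_succ_of_eq h, nearOne_self_eq_of_le l.le_succ, h]
      simp
      ring
    · rw [nearOne_succ_succ_of_ne h, geom_sum_rootOfUnity (hu l) h]
      simp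

theorem norm_eq_one (k : ℕ) : ‖u k‖ = 1 :=
  Complex.norm_eq_one_of_pow_eq_one (hu k) (by have := hm k; omega)

theorem norm_dirichletKernel_mul_le {s A : ℕ} (hs : s ≤ m A) :
    ‖dirichletKernel m u (s * M m A)‖ ≤ m A * M m A * nearOne u A A := by
  rw [dirichletKernel_mul hm u hs, dirichletKernel_M hm hu, norm_mul, norm_mul, Complex.norm_real,
    Complex.norm_natCast, Real.norm_of_nonneg (nearOne_nonneg _ _ _), mul_assoc]
  have h : ‖∑ q ∈ Finset.range s, u A ^ q‖ ≤ m A := by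
    refine (norm_sum_le _ _).trans ?_
    simp only [norm_pow, norm_eq_one hm hu, one_pow, Finset.sum_const, Finset.card_range,
      nsmul_eq_mul, mul_one]
    exact_mod_cast hs
  have := nearOne_nonneg u A A
  gcongr

variable {b : ℕ} (hb : ∀ k, m k ≤ b)

include hb

/-- The recursion for `D_1 + ⋯ + D_{M_l}` gains a factor `∑_{q < m_l} u_l ^ q`, which vanishes
unless `u_l = 1`; this yields the size of the kernel without computing it. -/
theorem norm_fejerSum_M_le' (l : ℕ) : ‖fejerSum m u (M m l)‖ ≤
    b * ∑ t ∈ Finset.range l, (M m t : ℝ) * M m l * nearOne u l t + M m l * nearOne u l l := by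
  induction l with
  | zero => simp [fejerSum, dirichletKernel, M, rootChar_zero hm, nearOne]
  | succ l ih =>
    have h1 : ‖∑ q ∈ Finset.range (m l), (M m l : ℂ) * dirichletKernel m u (q * M m l)‖ ≤
        b * ((M m l : ℝ) * M m (l + 1) * nearOne u (l + 1) l) := by
      calc _ ≤ ∑ q ∈ Finset.range (m l), (M m l : ℝ) * (m l * M m l * nearOne u l l) := by
            refine (norm_sum_le _ _).trans (Finset.sum_le_sum fun q hq => ?_)
            rw [norm_mul, Complex.norm_natCast]
            have := norm_dirichletKernel_mul_le hm hu (Finset.mem_range.1 hq).le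
            gcongr
        _ = m l * ((M m l : ℝ) * M m (l + 1) * nearOne u (l + 1) l) := by
            rw [nearOne_succ_self, M_succ, Finset.sum_const, Finset.card_range, nsmul_eq_mul]
            push_cast
            ring
        _ ≤ _ := by
            have := nearOne_nonneg u (l + 1) l
            have : (m l : ℝ) ≤ b := by exact_mod_cast hb l
            gcongr
    have h2 : ‖(∑ q ∈ Finset.range (m l), u l ^ q) * fejerSum m u (M m l)‖ ≤
        b * ∑ t ∈ Finset.range l, (M m t : ℝ) * M m (l + 1) * nearOne u (l + 1) t +
          M m (l + 1) * nearOne u (l + 1) (l + 1) := by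
      by_cases h : u l = 1
      · have : ∑ q ∈ Finset.range (m l), u l ^ q = m l := by simp [h]
        rw [this, norm_mul, Complex.norm_natCast]
        refine (mul_le_mul_of_nonneg_left ih (Nat.cast_nonneg _)).trans_eq ?_
        simp only [nearOne_succ_of_eq h, nearOne_self_eq_of_le l.le_succ, M_succ, Nat.cast_mul,
          Finset.mul_sum, mul_add]
        congr 1
        · exact Finset.sum_congr rfl fun t _ => by ring
        · ring
      · rw [geom_sum_rootOfUnity (hu l) h, zero_mul, norm_zero]
        have := nearOne_nonneg u (l + 1)
        exact add_nonneg (mul_nonneg (Nat.cast_nonneg _) (Finset.sum_nonneg fun t _ =>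
          mul_nonneg (by positivity) (this t))) (mul_nonneg (by positivity) (this _))
    have h3 := fejerSum_mul hm u (A := l) le_rfl
    rw [mul_comm, ← M_succ, Finset.sum_add_distrib, ← Finset.sum_mul] at h3
    rw [h3, Finset.sum_range_succ, mul_add]
    refine (norm_add_le _ _).trans ((add_le_add h1 h2).trans_eq ?_)
    ring

omit hm hu hb in
theorem majorant_nonneg (l : ℕ) : 0 ≤ majorant m u l :=
  Finset.sum_nonneg fun t _ => mul_nonneg (by positivity) (nearOne_nonneg u l t)

omit hm hu hb in
theorem sq_mul_nearOne_le_majorant (l : ℕ) :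
    (M m l : ℝ) * M m l * nearOne u l l ≤ majorant m u l :=
  Finset.single_le_sum (f := fun t => (M m t : ℝ) * M m l * nearOne u l t)
    (fun t _ => mul_nonneg (by positivity) (nearOne_nonneg u l t)) (by simp)

theorem norm_fejerSum_M_le (l : ℕ) : ‖fejerSum m u (M m l)‖ ≤ b * majorant m u l := by
  refine (norm_fejerSum_M_le' hm hu hb l).trans ?_
  rw [majorant, Finset.sum_range_succ, mul_add]
  refine add_le_add_right ?_ _
  have h1 : (1 : ℝ) ≤ M m l := by exact_mod_cast M_pos hm l
  have h2 : (1 : ℝ) ≤ b := by exact_mod_cast by have := hm 0; have := hb 0; omega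
  have := nearOne_nonneg u l l
  calc (M m l : ℝ) * nearOne u l l = 1 * (1 * M m l * nearOne u l l) := by ring
    _ ≤ _ := by gcongr

/-- For `n < M_A` the sum `D_1 + ⋯ + D_n` is dominated by `∑_{l < A} J_l`. -/
theorem norm_fejerSum_le {A n : ℕ} (hn : n < M m A) :
    ‖fejerSum m u n‖ ≤ 3 * b ^ 2 * ∑ l ∈ Finset.range A, majorant m u l := by
  induction A generalizing n with
  | zero =>
    have : n = 0 := by simpa [M] using hn
    simp [this, fejerSum]
  | succ A ih =>
    have hM := M_pos hm A
    set s := n / M m A with hs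
    set j := n % M m A with hj
    have hnj : n = s * M m A + j := by rw [hs, hj, mul_comm, Nat.div_add_mod]
    have hsm : s < m A := by rw [hs, Nat.div_lt_iff_lt_mul hM, mul_comm, ← M_succ]; exact hn
    have hjM : j < M m A := Nat.mod_lt _ hM
    have hbs : (s : ℝ) ≤ b := by exact_mod_cast hsm.le.trans (hb A)
    have hbA : (m A : ℝ) ≤ b := by exact_mod_cast hb A
    have h1b : (1 : ℝ) ≤ b := by exact_mod_cast by have := hm 0; have := hb 0; omega
    have hχ := nearOne_nonneg u A A
    have hJ := sq_mul_nearOne_le_majorant (m := m) (u := u) A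
    have hJ0 := majorant_nonneg (m := m) (u := u) A
    have hD : ∀ q ≤ m A, ‖(M m A : ℂ) * dirichletKernel m u (q * M m A)‖ ≤
        b * majorant m u A := fun q hq => by
      rw [norm_mul, Complex.norm_natCast]
      calc (M m A : ℝ) * ‖dirichletKernel m u (q * M m A)‖
          ≤ M m A * (m A * M m A * nearOne u A A) := by
            gcongr
            exact norm_dirichletKernel_mul_le hm hu hq
        _ = m A * (M m A * M m A * nearOne u A A) := by ring
        _ ≤ _ := by gcongr
    have h1 : ‖fejerSum m u (s * M m A)‖ ≤ 2 * b ^ 2 * majorant m u A := by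
      rw [fejerSum_mul hm u hsm.le]
      calc _ ≤ ∑ q ∈ Finset.range s, (b * majorant m u A + b * majorant m u A) := by
            refine (norm_sum_le _ _).trans (Finset.sum_le_sum fun q hq => ?_)
            refine (norm_add_le _ _).trans (add_le_add (hD q ?_) ?_)
            · exact (Finset.mem_range.1 hq).le.trans hsm.le
            · rw [norm_mul, norm_pow, norm_eq_one hm hu, one_pow, one_mul]
              exact norm_fejerSum_M_le hm hu hb A
        _ = s * (b * (2 * majorant m u A)) := by
            rw [Finset.sum_const, Finset.card_range, nsmul_eq_mul]
            ring
        _ ≤ b * (b * (2 * majorant m u A)) := by gcongr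
        _ = _ := by ring
    have h2 : ‖(j : ℂ) * dirichletKernel m u (s * M m A)‖ ≤ b ^ 2 * majorant m u A := by
      refine le_trans ?_ ((hD s hsm.le).trans ?_)
      · rw [norm_mul, norm_mul, Complex.norm_natCast, Complex.norm_natCast]
        gcongr
      · gcongr
        nlinarith
    have h3 : ‖u A ^ s * fejerSum m u j‖ ≤
        3 * b ^ 2 * ∑ l ∈ Finset.range A, majorant m u l := by
      rw [norm_mul, norm_pow, norm_eq_one hm hu, one_pow, one_mul]
      exact ih hjM
    rw [hnj, fejerSum_add hm u hsm hjM.le, Finset.sum_range_succ, mul_add]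
    refine (norm_add₃_le).trans ?_
    linarith

end Kernels

/-! ### Cylinders and averages -/

/-- The points agreeing with `x` in all coordinates `i < l`, except possibly `i = t`. For `t ≥ l`
this is the cylinder of rank `l` containing `x`. -/
def near {m : ℕ → ℕ} (l t : ℕ) (x : Group m) : Set (Group m) := {y | ∀ i < l, i ≠ t → y i = x i}

section Near

variable {m : ℕ → ℕ} {l t : ℕ} {x y : Group m}

theorem mem_near_comm : y ∈ near l t x ↔ x ∈ near l t y :=
  ⟨fun h i hi hit => (h i hi hit).symm, fun h i hi hit => (h i hi hit).symm⟩

theorem mem_near_of_mem_cylinder {z : Group m} (hz : z ∈ near l l y) (hy : y ∈ near l t x) :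
    z ∈ near l t x := fun i hi hit => (hz i hi hi.ne).trans (hy i hi hit)

theorem mem_cylinder_mono {k : ℕ} (hk : k ≤ l) (h : y ∈ near l l x) : y ∈ near k k x :=
  fun i hi _ => h i (hi.trans_le hk) (hi.trans_le hk).ne

theorem mem_cylinder_of_mem_near (ht : t ≤ l) (h : y ∈ near l t x) : y ∈ near t t x :=
  fun i hi hit => h i (hi.trans_le ht) hit

theorem near_eq_of_mem (h : y ∈ near l l x) : near l l y = near l l x :=
  Set.ext fun _ => ⟨fun hz => mem_near_of_mem_cylinder hz h,
    fun hz => mem_near_of_mem_cylinder hz (mem_near_comm.1 h)⟩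

variable (m l t) in
theorem measurableSet_near_prod : MeasurableSet {p : Group m × Group m | p.2 ∈ near l t p.1} := by
  have : {p : Group m × Group m | p.2 ∈ near l t p.1} =
      ⋂ i ∈ Set.Iio l, ⋂ (_ : i ≠ t), {p : Group m × Group m | p.2 i = p.1 i} := by
    ext p
    simp [near]
  rw [this]
  refine MeasurableSet.biInter (Set.to_countable _) fun i _ => MeasurableSet.iInter fun _ => ?_
  have hc : Countable (ZMod (m i)) := by
    cases m i
    · exact inferInstanceAs (Countable ℤ)
    · exact inferInstanceAs (Countable (Fin _))
  exact measurableSet_eq_fun (by fun_prop) (by fun_prop)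

variable (l t x) in
theorem measurableSet_near : MeasurableSet (near l t x) :=
  measurable_prodMk_left (x := x) (measurableSet_near_prod m l t)

end Near

section Measure

variable {m : ℕ → ℕ} (hm : ∀ k, 2 ≤ m k)

include hm

theorem haar_near_mul (l t : ℕ) (x : Group m) :
    haar m (near l t x) * ∏ i ∈ (Finset.range l).erase t, (m i : ℝ≥0∞) = 1 := by
  have := isProbabilityMeasure_coordMeasure hm
  have h : near l t x = (((Finset.range l).erase t : Finset ℕ) : Set ℕ).pi fun i => {x i} := by
    ext y
    simp only [near, Set.mem_ofPred_eq, Set.mem_pi, Finset.mem_coe, Finset.mem_erase,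
      Finset.mem_range, Set.mem_singleton_iff]
    exact ⟨fun h i hi => h i hi.2 hi.1, fun h i hi hit => h i ⟨hit, hi⟩⟩
  rw [h, haar, Measure.infinitePi_pi _ fun i _ => MeasurableSet.singleton _,
    ← Finset.prod_mul_distrib]
  refine Finset.prod_eq_one fun i _ => ?_
  rw [coordMeasure, Measure.smul_apply, Measure.count_singleton, smul_eq_mul, mul_one]
  exact ENNReal.inv_mul_cancel (by have := hm i; simp; omega) (by simp)

theorem haar_cylinder_mul (l : ℕ) (x : Group m) : haar m (near l l x) * M m l = 1 := by
  have := haar_near_mul hm l l x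
  rw [Finset.erase_eq_of_notMem (by simp)] at this
  rw [M]
  push_cast
  exact this

theorem haar_near_mul_le {b : ℕ} (hb : ∀ k, m k ≤ b) (l t : ℕ) (x : Group m) :
    haar m (near l t x) * M m l ≤ b := by
  have h1b : (1 : ℝ≥0∞) ≤ b := by exact_mod_cast by have := hm 0; have := hb 0; omega
  by_cases ht : t < l
  · rw [M, ← Finset.mul_prod_erase _ _ (Finset.mem_range.2 ht)]
    push_cast
    rw [mul_left_comm, haar_near_mul hm, mul_one]
    exact_mod_cast hb t
  · have h : near l t x = near l l x := by
      ext y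
      exact ⟨fun h i hi _ => h i hi (by omega), fun h i hi _ => h i hi (by omega)⟩
    rw [h, haar_cylinder_mul hm]
    exact h1b

end Measure

section Average

variable {m : ℕ → ℕ} (hm : ∀ k, 2 ≤ m k)

/-- The average of `F` over the cylinder of rank `l` containing `x`. -/
noncomputable def average (l : ℕ) (F : Group m → ℝ≥0∞) (x : Group m) : ℝ≥0∞ :=
  M m l * ∫⁻ y in near l l x, F y ∂haar m

theorem average_congr {l : ℕ} {F : Group m → ℝ≥0∞} {x y : Group m} (h : y ∈ near l l x) :
    average l F y = average l F x := by
  rw [average, average, near_eq_of_mem h]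

include hm

theorem measurable_lintegral_near (l t : ℕ) {F : Group m → ℝ≥0∞} (hF : Measurable F) :
    Measurable fun x => ∫⁻ y in near l t x, F y ∂haar m := by
  have := isProbabilityMeasure_haar hm
  have h : Measurable ({p : Group m × Group m | p.2 ∈ near l t p.1}.indicator fun p => F p.2) :=
    (hF.comp measurable_snd).indicator (measurableSet_near_prod m l t)
  convert h.lintegral_prod_right' (ν := haar m) using 2 with x
  rw [← lintegral_indicator (measurableSet_near l t x)]
  rfl

theorem measurable_average (l : ℕ) {F : Group m → ℝ≥0∞} (hF : Measurable F) :
    Measurable (average l F) := (measurable_lintegral_near hm l l hF).const_mul _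

theorem lintegral_lintegral_near (l t : ℕ) {F : Group m → ℝ≥0∞} (hF : Measurable F) :
    ∫⁻ x, ∫⁻ y in near l t x, F y ∂haar m ∂haar m = ∫⁻ y, F y * haar m (near l t y) ∂haar m := by
  have := isProbabilityMeasure_haar hm
  have h : Measurable ({p : Group m × Group m | p.2 ∈ near l t p.1}.indicator fun p => F p.2) :=
    (hF.comp measurable_snd).indicator (measurableSet_near_prod m l t)
  calc ∫⁻ x, ∫⁻ y in near l t x, F y ∂haar m ∂haar m
      = ∫⁻ x, ∫⁻ y, ({p : Group m × Group m | p.2 ∈ near l t p.1}.indicator fun p => F p.2) (x, y)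
          ∂haar m ∂haar m := by
        refine lintegral_congr fun x => ?_
        rw [← lintegral_indicator (measurableSet_near l t x)]
        rfl
    _ = ∫⁻ y, ∫⁻ x, ({p : Group m × Group m | p.2 ∈ near l t p.1}.indicator fun p => F p.2) (x, y)
          ∂haar m ∂haar m := lintegral_lintegral_swap h.aemeasurable
    _ = _ := by
        refine lintegral_congr fun y => ?_
        rw [← lintegral_indicator_const (measurableSet_near l t y)]
        refine lintegral_congr fun x => ?_
        by_cases hx : x ∈ near l t y
        · rw [Set.indicator_of_mem (show (x, y) ∈ {p : Group m × Group m | p.2 ∈ near l t p.1} from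
            mem_near_comm.1 hx), Set.indicator_of_mem hx]
        · rw [Set.indicator_of_notMem (show (x, y) ∉ {p : Group m × Group m | p.2 ∈ near l t p.1}
            from fun h => hx (mem_near_comm.1 h)), Set.indicator_of_notMem hx]

/-- Averaging over cylinders of rank `l` does not change integrals over unions of such cylinders. -/
theorem setLIntegral_average (l : ℕ) {F : Group m → ℝ≥0∞} (hF : Measurable F) {s : Set (Group m)}
    (hs : MeasurableSet s) (hinv : ∀ x ∈ s, ∀ y ∈ near l l x, y ∈ s) :
    ∫⁻ x in s, average l F x ∂haar m = ∫⁻ x in s, F x ∂haar m := by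
  have h : ∀ x, s.indicator (average l F) x =
      M m l * ∫⁻ y in near l l x, s.indicator F y ∂haar m := fun x => by
    by_cases hx : x ∈ s
    · rw [Set.indicator_of_mem hx, average]
      congr 1
      exact setLIntegral_congr_fun (measurableSet_near l l x) fun y hy =>
        (Set.indicator_of_mem (hinv x hx y hy) F).symm
    · rw [Set.indicator_of_notMem hx, setLIntegral_congr_fun (measurableSet_near l l x)
        (g := fun _ => 0) fun y hy => Set.indicator_of_notMem
          (fun hys => hx (hinv y hys x (mem_near_comm.1 hy))) F]
      simp
  rw [← lintegral_indicator hs, lintegral_congr h, lintegral_const_mul _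
    (measurable_lintegral_near hm l l (hF.indicator hs)), lintegral_lintegral_near hm l l
    (hF.indicator hs), ← lintegral_const_mul' _ _ (by simp), ← lintegral_indicator hs]
  refine lintegral_congr fun y => ?_
  rw [mul_left_comm, mul_comm (M m l : ℝ≥0∞), haar_cylinder_mul hm, mul_one]

end Average

/-! ### The maximal inequality -/

section Maximal

variable {m : ℕ → ℕ} (hm : ∀ k, 2 ≤ m k)

/-- The points at which all averages of rank at most `l` are bounded by `c`; the stopping time
`inf {k | average k F > c}` exceeds `l` exactly on this set. -/
def lowSet (c : ℝ≥0∞) (F : Group m → ℝ≥0∞) (l : ℕ) : Set (Group m) :=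
  {y | ∀ k ≤ l, average k F y ≤ c}

theorem lowSet_anti (c : ℝ≥0∞) (F : Group m → ℝ≥0∞) : Antitone (lowSet c F) :=
  fun _ _ hij _ hy k hk => hy k (hk.trans hij)

theorem mem_lowSet_of_mem_cylinder {c : ℝ≥0∞} {F : Group m → ℝ≥0∞} {l : ℕ} {x y : Group m}
    (hx : x ∈ lowSet c F l) (hy : y ∈ near l l x) : y ∈ lowSet c F l := fun k hk => by
  rw [average_congr (mem_cylinder_mono hk hy)]
  exact hx k hk

/-- The positive operator with kernel `J_l / M_l`, where `J_l` is the majorant of the Fejér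
kernel. -/
noncomputable def nearOperator (l : ℕ) (F : Group m → ℝ≥0∞) (x : Group m) : ℝ≥0∞ :=
  ∑ t ∈ Finset.range (l + 1), M m t * ∫⁻ y in near l t x, F y ∂haar m

/-- The contribution to `nearOperator l F` of the points with stopping time in `(t, l]`. -/
noncomputable def stoppedPart (c : ℝ≥0∞) (F : Group m → ℝ≥0∞) (l : ℕ) (x : Group m) : ℝ≥0∞ :=
  ∑ t ∈ Finset.range (l + 1),
    M m t * ∫⁻ y in near l t x, (lowSet c F t \ lowSet c F l).indicator F y ∂haar m

include hm

theorem measurableSet_lowSet (c : ℝ≥0∞) {F : Group m → ℝ≥0∞} (hF : Measurable F) (l : ℕ) :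
    MeasurableSet (lowSet c F l) := by
  have : lowSet c F l = ⋂ k ∈ Set.Iic l, {y | average k F y ≤ c} := by
    ext y
    simp [lowSet]
  rw [this]
  exact MeasurableSet.biInter (Set.to_countable _) fun k _ =>
    measurableSet_le (measurable_average hm k hF) measurable_const

theorem sum_M_le_M (k : ℕ) : ∑ t ∈ Finset.range k, M m t ≤ M m k := by
  induction k with
  | zero => simp
  | succ k ih =>
    rw [Finset.sum_range_succ]
    have := two_mul_M_le hm k
    omega

theorem M_ne_zero (k : ℕ) : (M m k : ℝ≥0∞) ≠ 0 := by
  exact_mod_cast (M_pos hm k).ne'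

/-- Doob's maximal inequality for the averages over cylinders. -/
theorem mul_haar_exists_average_gt_le (c : ℝ≥0∞) {F : Group m → ℝ≥0∞} (hF : Measurable F) :
    c * haar m {x | ∃ k, c < average k F x} ≤ ∫⁻ x, F x ∂haar m := by
  set s : ℕ → Set (Group m) := fun k => {x | (∀ j < k, average j F x ≤ c) ∧ c < average k F x}
    with hs
  have hmeas : ∀ k, MeasurableSet (s k) := fun k => by
    have : s k = (⋂ j ∈ Set.Iio k, {y | average j F y ≤ c}) ∩ {y | c < average k F y} := by
      ext y
      simp [hs]
    rw [this]
    exact (MeasurableSet.biInter (Set.to_countable _) fun j _ =>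
      measurableSet_le (measurable_average hm j hF) measurable_const).inter
      (measurableSet_lt measurable_const (measurable_average hm k hF))
  have hdisj : Pairwise (Function.onFun Disjoint s) := by
    intro i j hij
    refine Set.disjoint_left.2 fun x hi hj => ?_
    rcases lt_or_gt_of_ne hij with h | h
    · exact absurd hi.2 (not_lt.2 (hj.1 i h))
    · exact absurd hj.2 (not_lt.2 (hi.1 j h))
  have hunion : {x | ∃ k, c < average k F x} ⊆ ⋃ k, s k := fun x hx => by
    classical
    have h : ∃ k, c < average k F x := hx
    exact Set.mem_iUnion.2 ⟨Nat.find h, fun j hj => not_lt.1 (Nat.find_min h hj), Nat.find_spec h⟩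
  calc c * haar m {x | ∃ k, c < average k F x} ≤ c * ∑' k, haar m (s k) := by
        gcongr
        exact (measure_mono hunion).trans (measure_iUnion_le _)
    _ = ∑' k, c * haar m (s k) := ENNReal.tsum_mul_left.symm
    _ ≤ ∑' k, ∫⁻ x in s k, F x ∂haar m := by
        refine ENNReal.tsum_le_tsum fun k => ?_
        rw [← setLIntegral_average hm k hF (hmeas k), ← setLIntegral_const]
        · exact setLIntegral_mono (measurable_average hm k hF) fun x hx => hx.2.le
        · intro x hx y hy
          refine ⟨fun j hj => ?_, ?_⟩
          · rw [average_congr (mem_cylinder_mono hj.le hy)]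
            exact hx.1 j hj
          · rw [average_congr hy]
            exact hx.2
    _ = ∫⁻ x in ⋃ k, s k, F x ∂haar m := (lintegral_iUnion hmeas hdisj F).symm
    _ ≤ _ := setLIntegral_le_lintegral _ _

theorem sum_M_mul_haar_near_le {b : ℕ} (hb : ∀ k, m k ≤ b) (l : ℕ) (x : Group m) :
    ∑ t ∈ Finset.range (l + 1), M m t * haar m (near l t x) ≤ 2 * b := by
  have h1 : ∀ t, haar m (near l t x) ≤ b * (M m l : ℝ≥0∞)⁻¹ := fun t => by
    rw [← div_eq_mul_inv, ENNReal.le_div_iff_mul_le (Or.inl (M_ne_zero hm l)) (Or.inl (by simp))]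
    exact haar_near_mul_le hm hb l t x
  have h2 : ∑ t ∈ Finset.range (l + 1), (M m t : ℝ≥0∞) ≤ 2 * M m l := by
    have := sum_M_le_M hm l
    rw [Finset.sum_range_succ]
    exact_mod_cast by omega
  calc _ ≤ ∑ t ∈ Finset.range (l + 1), M m t * (b * (M m l : ℝ≥0∞)⁻¹) := by
        gcongr with t
        exact h1 t
    _ ≤ 2 * M m l * (b * (M m l : ℝ≥0∞)⁻¹) := by
        rw [← Finset.sum_mul]
        gcongr
    _ = 2 * b * (M m l * (M m l : ℝ≥0∞)⁻¹) := by ring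
    _ = 2 * b := by rw [ENNReal.mul_inv_cancel (M_ne_zero hm l) (by simp), mul_one]

/-- If no average of `F` at `x` exceeds `c`, then no point of `near l t x` has stopping time at most
`t`, because it shares its first `t` coordinates with `x`; points with stopping time greater than
`l` contribute at most a multiple of `c`. -/
theorem nearOperator_le {b : ℕ} (hb : ∀ k, m k ≤ b) {c : ℝ≥0∞} {F : Group m → ℝ≥0∞}
    (hF : Measurable F) {x : Group m} (hx : ∀ k, average k F x ≤ c) (l : ℕ) :
    nearOperator l F x ≤ 2 * b * c + stoppedPart c F l x := by
  have key : ∀ t ∈ Finset.range (l + 1), M m t * ∫⁻ y in near l t x, F y ∂haar m ≤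
      M m t * haar m (near l t x) * c +
      M m t * ∫⁻ y in near l t x, (lowSet c F t \ lowSet c F l).indicator F y ∂haar m := by
    intro t ht
    have htl : t ≤ l := Nat.lt_succ_iff.1 (Finset.mem_range.1 ht)
    rw [mul_assoc, ← mul_add]
    gcongr
    have hlow := measurableSet_lowSet hm c hF l
    rw [← lintegral_inter_add_sdiff F (near l t x) hlow]
    refine add_le_add ?_ ?_
    · rw [← setLIntegral_average hm l hF ((measurableSet_near l t x).inter hlow)]
      · calc _ ≤ ∫⁻ y in near l t x ∩ lowSet c F l, c ∂haar m :=
              setLIntegral_mono measurable_const fun y hy => hy.2 l le_rfl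
          _ ≤ _ := by
              rw [setLIntegral_const, mul_comm]
              gcongr
              exact Set.inter_subset_left
      · exact fun y hy z hz =>
          ⟨mem_near_of_mem_cylinder hz hy.1, mem_lowSet_of_mem_cylinder hy.2 hz⟩
    · have hd := ((measurableSet_lowSet hm c hF t).diff hlow)
      rw [setLIntegral_indicator hd]
      refine lintegral_mono_set fun y hy => ⟨⟨?_, hy.2⟩, hy.1⟩
      exact mem_lowSet_of_mem_cylinder (fun k _ => hx k) (mem_cylinder_of_mem_near htl hy.1)
  calc nearOperator l F x ≤ _ := Finset.sum_le_sum key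
    _ = (∑ t ∈ Finset.range (l + 1), M m t * haar m (near l t x)) * c + stoppedPart c F l x := by
        rw [Finset.sum_add_distrib, ← Finset.sum_mul]
        rfl
    _ ≤ _ := by
        gcongr
        exact sum_M_mul_haar_near_le hm hb l x

/-- With `τ` the stopping time, the left side is `∑_{l ≥ τ} ∑_{t < τ} M_t / M_l`. Here
`∑_{t < τ} M_t ≤ M_τ` and `M_τ / M_l ≤ 2 ^ (τ - l)`. -/
theorem tsum_sum_indicator_le (c : ℝ≥0∞) (F : Group m → ℝ≥0∞) (y : Group m) :
    ∑' l, ∑ t ∈ Finset.range (l + 1), M m t * (M m l : ℝ≥0∞)⁻¹ *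
      (lowSet c F t \ lowSet c F l).indicator (fun _ => 1) y ≤ 2 := by
  classical
  by_cases h : ∃ l, y ∉ lowSet c F l
  swap
  · push Not at h
    simp [h]
  set τ := Nat.find h with hτ
  have hlt : ∀ t, y ∈ lowSet c F t → t < τ := fun t ht => by
    by_contra hcon
    exact Nat.find_spec h (lowSet_anti c F (not_lt.1 hcon) ht)
  have hle : ∀ l, y ∉ lowSet c F l → τ ≤ l := fun l hl => Nat.find_min' h hl
  have h1 : ∀ l, ∑ t ∈ Finset.range (l + 1), M m t * (M m l : ℝ≥0∞)⁻¹ *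
      (lowSet c F t \ lowSet c F l).indicator (fun _ => 1) y ≤
      if τ ≤ l then M m τ * (M m l : ℝ≥0∞)⁻¹ else 0 := by
    intro l
    by_cases hl : y ∈ lowSet c F l
    · simp [hl]
    rw [if_pos (hle l hl)]
    have h2 : ∑ t ∈ Finset.range τ, (M m t : ℝ≥0∞) ≤ M m τ := by
      exact_mod_cast sum_M_le_M hm τ
    refine le_trans ?_ (mul_le_mul_left h2 _)
    have hsub : Finset.range τ ⊆ Finset.range (l + 1) :=
      Finset.range_mono ((hle l hl).trans l.le_succ)
    rw [Finset.sum_mul, ← Finset.sum_subset hsub fun t _ ht => by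
      rw [Set.indicator_of_notMem fun h => ht (Finset.mem_range.2 (hlt t h.1)), mul_zero]]
    refine Finset.sum_le_sum fun t _ => mul_le_of_le_one_right' ?_
    exact Set.indicator_apply_le' (fun _ => le_rfl) fun _ => zero_le
  refine (ENNReal.tsum_le_tsum h1).trans ?_
  rw [← Summable.sum_add_tsum_nat_add' (k := τ) ENNReal.summable, Finset.sum_eq_zero fun l hl =>
    if_neg (not_le.2 (Finset.mem_range.1 hl)), zero_add]
  have h3 : ∀ i : ℕ, 2 ^ i * M m τ ≤ M m (i + τ) := by
    intro i
    induction i with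
    | zero => simp
    | succ i ih =>
      rw [pow_succ', mul_assoc, add_right_comm]
      exact (Nat.mul_le_mul_left 2 ih).trans (two_mul_M_le hm _)
  calc _ ≤ ∑' i : ℕ, (2⁻¹ : ℝ≥0∞) ^ i := by
        refine ENNReal.tsum_le_tsum fun i => ?_
        rw [if_pos (Nat.le_add_left τ i), ← div_eq_mul_inv]
        refine ENNReal.div_le_of_le_mul ?_
        rw [← ENNReal.inv_pow, mul_comm, ← div_eq_mul_inv,
          ENNReal.le_div_iff_mul_le (by simp) (by simp), mul_comm]
        exact_mod_cast h3 i
    _ = 2 := by rw [ENNReal.tsum_geometric, ENNReal.one_sub_inv_two, inv_inv]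

theorem measurable_stoppedPart (c : ℝ≥0∞) {F : Group m → ℝ≥0∞} (hF : Measurable F) (l : ℕ) :
    Measurable (stoppedPart c F l) :=
  Finset.measurable_sum _ fun t _ => (measurable_lintegral_near hm l t (hF.indicator
    ((measurableSet_lowSet hm c hF t).diff (measurableSet_lowSet hm c hF l)))).const_mul _

theorem lintegral_tsum_stoppedPart_le {b : ℕ} (hb : ∀ k, m k ≤ b) (c : ℝ≥0∞)
    {F : Group m → ℝ≥0∞} (hF : Measurable F) :
    ∫⁻ x, ∑' l, stoppedPart c F l x ∂haar m ≤ 2 * b * ∫⁻ x, F x ∂haar m := by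
  have hd : ∀ l t, MeasurableSet (lowSet c F t \ lowSet c F l) := fun l t =>
    (measurableSet_lowSet hm c hF t).diff (measurableSet_lowSet hm c hF l)
  have hG : ∀ l t, Measurable fun y => b * F y * (M m t * (M m l : ℝ≥0∞)⁻¹ *
      (lowSet c F t \ lowSet c F l).indicator (fun _ => 1) y) := fun l t =>
    (hF.const_mul _).mul ((measurable_const.indicator (hd l t)).const_mul _)
  have h1 : ∀ l, ∫⁻ x, stoppedPart c F l x ∂haar m ≤
      ∫⁻ y, ∑ t ∈ Finset.range (l + 1), b * F y * (M m t * (M m l : ℝ≥0∞)⁻¹ *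
        (lowSet c F t \ lowSet c F l).indicator (fun _ => 1) y) ∂haar m := by
    intro l
    simp only [stoppedPart]
    rw [lintegral_finsetSum _ fun t _ => (measurable_lintegral_near hm l t
      (hF.indicator (hd l t))).const_mul _, lintegral_finsetSum _ fun t _ => hG l t]
    refine Finset.sum_le_sum fun t _ => ?_
    rw [lintegral_const_mul _ (measurable_lintegral_near hm l t (hF.indicator (hd l t))),
      lintegral_lintegral_near hm l t (hF.indicator (hd l t)),
      ← lintegral_const_mul' _ _ (by simp)]
    refine lintegral_mono fun y => ?_
    have h2 : haar m (near l t y) ≤ b * (M m l : ℝ≥0∞)⁻¹ := by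
      rw [← div_eq_mul_inv, ENNReal.le_div_iff_mul_le (Or.inl (M_ne_zero hm l)) (Or.inl (by simp))]
      exact haar_near_mul_le hm hb l t y
    by_cases hy : y ∈ lowSet c F t \ lowSet c F l
    · rw [Set.indicator_of_mem hy, Set.indicator_of_mem hy]
      calc (M m t : ℝ≥0∞) * (F y * haar m (near l t y))
          ≤ M m t * (F y * (b * (M m l : ℝ≥0∞)⁻¹)) := by gcongr
        _ = _ := by ring
    · simp [Set.indicator_of_notMem hy]
  calc ∫⁻ x, ∑' l, stoppedPart c F l x ∂haar m = ∑' l, ∫⁻ x, stoppedPart c F l x ∂haar m :=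
        lintegral_tsum fun l => (measurable_stoppedPart hm c hF l).aemeasurable
    _ ≤ _ := ENNReal.tsum_le_tsum h1
    _ = ∫⁻ y, ∑' l, ∑ t ∈ Finset.range (l + 1), b * F y * (M m t * (M m l : ℝ≥0∞)⁻¹ *
        (lowSet c F t \ lowSet c F l).indicator (fun _ => 1) y) ∂haar m :=
        (lintegral_tsum fun l => (Finset.measurable_sum _ fun t _ => hG l t).aemeasurable).symm
    _ ≤ ∫⁻ y, b * F y * 2 ∂haar m := by
        refine lintegral_mono fun y => ?_
        simp_rw [← Finset.mul_sum, ENNReal.tsum_mul_left]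
        gcongr
        exact tsum_sum_indicator_le hm c F y
    _ = _ := by
        rw [← lintegral_const_mul _ hF]
        exact lintegral_congr fun y => by ring

/-- The maximal operator `sup_l nearOperator l` is of weak type `(1, 1)`. -/
theorem mul_haar_exists_nearOperator_gt_le {b : ℕ} (hb : ∀ k, m k ≤ b) (c : ℝ≥0∞)
    {F : Group m → ℝ≥0∞} (hF : Measurable F) :
    c * haar m {x | ∃ l, (2 * b + 1) * c < nearOperator l F x} ≤
      (2 * b + 1) * ∫⁻ x, F x ∂haar m := by
  have hsub : {x | ∃ l, (2 * b + 1) * c < nearOperator l F x} ⊆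
      {x | c ≤ ∑' l, stoppedPart c F l x} ∪ {x | ∃ k, c < average k F x} := by
    rintro x ⟨l, hl⟩
    by_contra h
    rw [Set.mem_union, not_or] at h
    simp only [Set.mem_ofPred_eq, not_exists, not_lt, not_le] at h
    refine absurd hl (not_lt.2 ((nearOperator_le hm hb hF h.2 l).trans ?_))
    rw [add_mul, one_mul]
    gcongr
    exact (ENNReal.le_tsum l).trans h.1.le
  calc _ ≤ c * (haar m {x | c ≤ ∑' l, stoppedPart c F l x} +
        haar m {x | ∃ k, c < average k F x}) := by
        gcongr
        exact (measure_mono hsub).trans (measure_union_le _ _)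
    _ ≤ 2 * b * ∫⁻ x, F x ∂haar m + ∫⁻ x, F x ∂haar m := by
        rw [mul_add]
        refine add_le_add ?_ (mul_haar_exists_average_gt_le hm c hF)
        exact (mul_meas_ge_le_lintegral
          (Measurable.tsum fun l => measurable_stoppedPart hm c hF l) c).trans
          (lintegral_tsum_stoppedPart_le hm hb c hF)
    _ = _ := by ring

end Maximal

/-! ### Vilenkin functions and the kernel representation -/

section Characters

variable {m : ℕ → ℕ} (hm : ∀ k, 2 ≤ m k)

theorem psi_eq_rootChar (m : ℕ → ℕ) (n : ℕ) (x : Group m) :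
    psi m n x = rootChar m (fun k => rademacher m k x) n := rfl

theorem rademacher_eq_pow (m : ℕ → ℕ) (k : ℕ) (x : Group m) :
    rademacher m k x = Complex.exp (2 * Real.pi * Complex.I / (m k : ℂ)) ^ (x k).val := by
  rw [rademacher, ← Complex.exp_nat_mul]
  congr 1
  ring

/-- The values of `u_k = r_k(x) * conj (r_k(y))`; they encode `x - y`. -/
noncomputable def ratio (x y : Group m) (k : ℕ) : ℂ := rademacher m k x * conj (rademacher m k y)

include hm

theorem isPrimitiveRoot_exp_div (k : ℕ) :
    IsPrimitiveRoot (Complex.exp (2 * Real.pi * Complex.I / (m k : ℂ))) (m k) :=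
  Complex.isPrimitiveRoot_exp _ (by have := hm k; omega)

theorem rademacher_pow (k : ℕ) (x : Group m) : rademacher m k x ^ m k = 1 := by
  rw [rademacher_eq_pow, pow_right_comm, (isPrimitiveRoot_exp_div hm k).pow_eq_one, one_pow]

theorem rademacher_mul_conj (k : ℕ) (x : Group m) :
    rademacher m k x * conj (rademacher m k x) = 1 := by
  rw [Complex.mul_conj, Complex.normSq_eq_norm_sq,
    norm_eq_one (u := fun k => rademacher m k x) hm (fun k => rademacher_pow hm k x)]
  simp

theorem rademacher_inj {k : ℕ} {x y : Group m} (h : rademacher m k x = rademacher m k y) :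
    x k = y k := by
  have : NeZero (m k) := ⟨by have := hm k; omega⟩
  rw [rademacher_eq_pow, rademacher_eq_pow] at h
  exact ZMod.val_injective _
    ((isPrimitiveRoot_exp_div hm k).pow_inj (ZMod.val_lt _) (ZMod.val_lt _) h)

theorem rademacher_add (k : ℕ) (x y : Group m) :
    rademacher m k (x + y) = rademacher m k x * rademacher m k y := by
  have : NeZero (m k) := ⟨by have := hm k; omega⟩
  rw [rademacher_eq_pow, rademacher_eq_pow, rademacher_eq_pow, Pi.add_apply, ZMod.val_add,
    ← pow_add]
  exact (pow_eq_pow_mod _ (isPrimitiveRoot_exp_div hm k).pow_eq_one).symm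

theorem ratio_pow (x y : Group m) (k : ℕ) : ratio x y k ^ m k = 1 := by
  rw [ratio, mul_pow, ← map_pow, rademacher_pow hm, rademacher_pow hm, map_one, mul_one]

theorem ratio_eq_one_iff (x y : Group m) (k : ℕ) : ratio x y k = 1 ↔ y k = x k := by
  constructor
  · intro h
    refine (rademacher_inj hm ?_).symm
    calc rademacher m k x = ratio x y k * rademacher m k y := by
          rw [ratio, mul_assoc, mul_comm (conj _), rademacher_mul_conj hm, mul_one]
      _ = rademacher m k y := by rw [h, one_mul]
  · intro h
    have : rademacher m k y = rademacher m k x := by rw [rademacher, rademacher, h]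
    rw [ratio, this, rademacher_mul_conj hm]

theorem nearOne_ratio (x y : Group m) (l t : ℕ) :
    nearOne (ratio x y) l t = (near l t x).indicator (fun _ => 1) y := by
  classical
  rw [Set.indicator_apply, nearOne]
  congr 1
  simp only [ratio_eq_one_iff hm]
  rfl

theorem exists_lt_M (n : ℕ) : n < M m (n + 1) :=
  ((M_strictMono hm).le_apply (x := n)).trans_lt (M_strictMono hm n.lt_succ_self)

theorem psi_mul_conj_psi (n : ℕ) (x y : Group m) :
    psi m n x * conj (psi m n y) = rootChar m (ratio x y) n := by
  rw [psi_eq_rootChar, psi_eq_rootChar, rootChar_eq_prod hm _ (exists_lt_M hm n),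
    rootChar_eq_prod hm _ (exists_lt_M hm n), rootChar_eq_prod hm _ (exists_lt_M hm n), map_prod,
    ← Finset.prod_mul_distrib]
  exact Finset.prod_congr rfl fun k _ => by rw [map_pow, ← mul_pow, ratio]

theorem psi_add (n : ℕ) (x y : Group m) : psi m n (x + y) = psi m n x * psi m n y := by
  rw [psi_eq_rootChar, psi_eq_rootChar, psi_eq_rootChar, rootChar_eq_prod hm _ (exists_lt_M hm n),
    rootChar_eq_prod hm _ (exists_lt_M hm n), rootChar_eq_prod hm _ (exists_lt_M hm n),
    ← Finset.prod_mul_distrib]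
  exact Finset.prod_congr rfl fun k _ => by rw [rademacher_add hm, mul_pow]

theorem norm_psi (n : ℕ) (x : Group m) : ‖psi m n x‖ = 1 := by
  rw [psi_eq_rootChar, rootChar_eq_prod hm _ (exists_lt_M hm n), norm_prod]
  refine Finset.prod_eq_one fun k _ => ?_
  rw [norm_pow, norm_eq_one (u := fun k => rademacher m k x) hm (fun k => rademacher_pow hm k x),
    one_pow]

theorem measurable_psi (n : ℕ) : Measurable (psi m n) := by
  have h : psi m n = fun x => ∏ k ∈ Finset.range (n + 1), rademacher m k x ^ digit m n k :=
    funext fun x => by rw [psi_eq_rootChar, rootChar_eq_prod hm _ (exists_lt_M hm n)]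
  rw [h]
  refine Finset.measurable_prod _ fun k _ => Measurable.pow_const ?_ _
  have hr : Measurable fun z : ZMod (m k) =>
      Complex.exp (2 * Real.pi * Complex.I * (z.val : ℂ) / (m k : ℂ)) := measurable_from_top
  exact hr.comp (measurable_pi_apply k)

variable {f g : Group m → ℂ} (hf : Integrable f (haar m))

include hf

theorem integrable_mul_conj_psi (n : ℕ) :
    Integrable (fun y => f y * conj (psi m n y)) (haar m) := by
  refine hf.mul_bdd (c := 1) ?_ (Eventually.of_forall fun y => ?_)
  · exact (Complex.continuous_conj.measurable.comp (measurable_psi hm n)).aestronglyMeasurable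
  · rw [RCLike.norm_conj, norm_psi hm]

theorem integrable_mul_rootChar (n : ℕ) (x : Group m) :
    Integrable (fun y => f y * rootChar m (ratio x y) n) (haar m) := by
  simp_rw [← psi_mul_conj_psi hm, mul_left_comm (f _)]
  exact (integrable_mul_conj_psi hm hf n).const_mul _

omit hf in
theorem coeff_mul_psi (n : ℕ) (x : Group m) :
    coeff m f n * psi m n x = ∫ y, f y * rootChar m (ratio x y) n ∂haar m := by
  rw [coeff, ← integral_mul_const]
  refine integral_congr_ae (Eventually.of_forall fun y => ?_)
  simp only [← psi_mul_conj_psi hm]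
  ring

theorem integrable_mul_dirichletKernel (n : ℕ) (x : Group m) :
    Integrable (fun y => f y * dirichletKernel m (ratio x y) n) (haar m) := by
  simp only [dirichletKernel, Finset.mul_sum]
  exact integrable_finsetSum _ fun k _ => integrable_mul_rootChar hm hf k x

theorem partialSum_eq_integral (n : ℕ) (x : Group m) :
    partialSum m f n x = ∫ y, f y * dirichletKernel m (ratio x y) n ∂haar m := by
  simp only [partialSum, dirichletKernel, Finset.mul_sum]
  rw [integral_finsetSum _ fun k _ => integrable_mul_rootChar hm hf k x]
  exact Finset.sum_congr rfl fun k _ => coeff_mul_psi hm k x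

theorem sum_partialSum_eq_integral (n : ℕ) (x : Group m) :
    ∑ k ∈ Finset.range n, partialSum m f (k + 1) x =
      ∫ y, f y * fejerSum m (ratio x y) n ∂haar m := by
  simp only [fejerSum, Finset.mul_sum]
  rw [integral_finsetSum _ fun k _ => integrable_mul_dirichletKernel hm hf (k + 1) x]
  exact Finset.sum_congr rfl fun k _ => partialSum_eq_integral hm hf (k + 1) x

theorem partialSum_sub (hg : Integrable g (haar m)) (n : ℕ) (x : Group m) :
    partialSum m (f - g) n x = partialSum m f n x - partialSum m g n x := by
  rw [partialSum_eq_integral hm hf, partialSum_eq_integral hm hg,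
    partialSum_eq_integral hm (hf.sub hg), ← integral_sub
      (integrable_mul_dirichletKernel hm hf n x) (integrable_mul_dirichletKernel hm hg n x)]
  simp [sub_mul]

end Characters

/-! ### Domination of the Fejér means -/

section Domination

variable {m : ℕ → ℕ} (hm : ∀ k, 2 ≤ m k)

include hm

/-- The rank of the leading digit. -/
theorem exists_M_le_lt {n : ℕ} (hn : n ≠ 0) : ∃ A, M m A ≤ n ∧ n < M m (A + 1) := by
  classical
  have h : ∃ A, n < M m A := ⟨_, exists_lt_M hm n⟩
  have h0 : Nat.find h ≠ 0 := fun h0 => by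
    have := Nat.find_spec h
    rw [h0] at this
    simp [M] at this
    exact hn this
  obtain ⟨A, hA⟩ := Nat.exists_eq_succ_of_ne_zero h0
  refine ⟨A, not_lt.1 (Nat.find_min h (by omega)), ?_⟩
  have := Nat.find_spec h
  rwa [hA] at this

theorem lintegral_enorm_mul_majorant (l : ℕ) {F : Group m → ℝ≥0∞} (hF : Measurable F)
    (x : Group m) :
    ∫⁻ y, F y * ENNReal.ofReal (majorant m (ratio x y) l) ∂haar m = M m l * nearOperator l F x := by
  have h : ∀ y, F y * ENNReal.ofReal (majorant m (ratio x y) l) =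
      ∑ t ∈ Finset.range (l + 1), (M m t * M m l : ℝ≥0∞) * (near l t x).indicator F y := fun y => by
    rw [majorant, ENNReal.ofReal_sum_of_nonneg fun t _ =>
      mul_nonneg (by positivity) (nearOne_nonneg _ l t), Finset.mul_sum]
    refine Finset.sum_congr rfl fun t _ => ?_
    rw [nearOne_ratio hm, ENNReal.ofReal_mul (by positivity), ENNReal.ofReal_mul (by positivity),
      ENNReal.ofReal_natCast, ENNReal.ofReal_natCast, mul_left_comm]
    congr 1
    by_cases hy : y ∈ near l t x <;> simp [hy]
  have hmeas : ∀ t, Measurable ((near l t x).indicator F) := fun t =>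
    hF.indicator (measurableSet_near l t x)
  rw [lintegral_congr h, lintegral_finsetSum _ fun t _ => (hmeas t).const_mul _, nearOperator,
    Finset.mul_sum]
  refine Finset.sum_congr rfl fun t _ => ?_
  rw [lintegral_const_mul _ (hmeas t), lintegral_indicator (measurableSet_near l t x)]
  ring

theorem norm_sum_partialSum_le {b : ℕ} (hb : ∀ k, m k ≤ b) {f : Group m → ℂ} (hfm : Measurable f)
    (hf : Integrable f (haar m)) {x : Group m} {K : ℝ≥0}
    (hK : ∀ l, nearOperator l (fun y => ‖f y‖ₑ) x ≤ K) (n : ℕ) :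
    ‖∑ k ∈ Finset.range n, partialSum m f (k + 1) x‖ ≤ 6 * b ^ 2 * K * n := by
  rcases eq_or_ne n 0 with rfl | hn
  · simp
  obtain ⟨A, hA, hnA⟩ := exists_M_le_lt hm hn
  have hM : ∑ l ∈ Finset.range (A + 1), (M m l : ℝ≥0∞) ≤ 2 * n := by
    have := sum_M_le_M hm A
    rw [Finset.sum_range_succ]
    exact_mod_cast by omega
  have hJm : ∀ l, Measurable fun y => ‖f y‖ₑ * ENNReal.ofReal (majorant m (ratio x y) l) :=
    fun l => by
      refine hfm.enorm.mul (ENNReal.measurable_ofReal.comp ?_)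
      simp only [majorant, nearOne_ratio hm]
      exact Finset.measurable_sum _ fun t _ =>
        (measurable_const.indicator (measurableSet_near l t x)).const_mul _
  have key : ‖∑ k ∈ Finset.range n, partialSum m f (k + 1) x‖ₑ ≤ 3 * b ^ 2 * (2 * n * K) := by
    rw [sum_partialSum_eq_integral hm hf]
    calc _ ≤ ∫⁻ y, ‖f y * fejerSum m (ratio x y) n‖ₑ ∂haar m := enorm_integral_le_lintegral_enorm _
      _ ≤ ∫⁻ y, 3 * b ^ 2 * ∑ l ∈ Finset.range (A + 1),
          ‖f y‖ₑ * ENNReal.ofReal (majorant m (ratio x y) l) ∂haar m := by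
          refine lintegral_mono fun y => ?_
          rw [enorm_mul, ← Finset.mul_sum, mul_left_comm]
          gcongr
          rw [← ofReal_norm, ← ENNReal.ofReal_sum_of_nonneg fun l _ => majorant_nonneg l]
          have h3 : (3 * b ^ 2 : ℝ≥0∞) = ENNReal.ofReal (3 * b ^ 2) := by
            rw [ENNReal.ofReal_mul (by norm_num), ENNReal.ofReal_pow (by positivity)]
            simp
          rw [h3, ← ENNReal.ofReal_mul (by positivity)]
          exact ENNReal.ofReal_le_ofReal (norm_fejerSum_le hm (ratio_pow hm x y) hb hnA)
      _ = 3 * b ^ 2 * ∑ l ∈ Finset.range (A + 1),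
          M m l * nearOperator l (fun y => ‖f y‖ₑ) x := by
          rw [lintegral_const_mul _ (Finset.measurable_sum _ fun l _ => hJm l),
            lintegral_finsetSum _ fun l _ => hJm l]
          simp_rw [lintegral_enorm_mul_majorant hm _ hfm.enorm]
      _ ≤ 3 * b ^ 2 * ((∑ l ∈ Finset.range (A + 1), (M m l : ℝ≥0∞)) * K) := by
          rw [Finset.sum_mul]
          gcongr with l
          exact hK l
      _ ≤ _ := by gcongr
  have h : (3 * b ^ 2 * (2 * n * K) : ℝ≥0∞) = ((6 * b ^ 2 * K * n : ℝ≥0) : ℝ≥0∞) := by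
    push_cast
    ring
  rw [h, enorm_le_coe] at key
  exact_mod_cast key

end Domination

/-! ### Locally constant functions -/

section LocallyConstant

variable {m : ℕ → ℕ} (hm : ∀ k, 2 ≤ m k)

include hm

theorem measurePreserving_add_right_haar (c : Group m) :
    MeasurePreserving (fun x => x + c) (haar m) (haar m) := by
  have := isProbabilityMeasure_coordMeasure hm
  refine ⟨by fun_prop, ?_⟩
  have hmap : ∀ k, (coordMeasure m k).map (fun z => z + c k) = coordMeasure m k := fun k => by
    rw [coordMeasure, Measure.map_smul, map_add_right_eq_self]
  have := Measure.infinitePi_map_pi (coordMeasure m) (f := fun k z => z + c k)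
    fun k => measurable_from_top
  simp_rw [hmap] at this
  exact this

/-- A function constant on the cylinders of rank `k` has no Fourier coefficients beyond `M_k`:
translation in the coordinate of the leading digit of `n` preserves the function, but multiplies
`ψ_n` by a nontrivial root of unity. -/
theorem coeff_eq_zero {k : ℕ} {g : Group m → ℂ} (hg : ∀ x, ∀ y ∈ near k k x, g y = g x) {n : ℕ}
    (hn : M m k ≤ n) : coeff m g n = 0 := by
  obtain ⟨A, hA, hnA⟩ := exists_M_le_lt hm (n := n) (by have := M_pos hm k; omega)
  have hkA : k ≤ A := by
    by_contra h
    have := (M_strictMono hm).monotone (show A + 1 ≤ k by omega)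
    omega
  have hdig : digit m n A = n / M m A := Nat.mod_eq_of_lt <| by
    rw [Nat.div_lt_iff_lt_mul (M_pos hm A), mul_comm, ← M_succ]
    exact hnA
  have hdig0 : digit m n A ≠ 0 := by
    rw [hdig]
    exact (Nat.div_pos hA (M_pos hm A)).ne'
  have hdigm : digit m n A < m A := Nat.mod_lt _ (by have := hm A; omega)
  set c : Group m := Pi.single A 1 with hc
  have hψc : psi m n c ≠ 1 := by
    have h1 : Fact (1 < m A) := ⟨hm A⟩
    rw [psi_eq_rootChar, rootChar_eq_prod hm _ hnA, Finset.prod_eq_single A]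
    · rw [rademacher_eq_pow, hc, Pi.single_eq_same, ZMod.val_one, pow_one]
      exact (isPrimitiveRoot_exp_div hm A).pow_ne_one_of_pos_of_lt hdig0 hdigm
    · intro i _ hi
      rw [rademacher_eq_pow, hc, Pi.single_eq_of_ne hi, ZMod.val_zero, pow_zero, one_pow]
    · simp
  have hgc : ∀ x, g (x + c) = g x := fun x => hg x _ fun i hi _ => by
    rw [Pi.add_apply, hc, Pi.single_eq_of_ne (by omega), add_zero]
  have hinv : coeff m g n = coeff m g n * conj (psi m n c) := by
    have hmp := measurePreserving_add_right_haar hm c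
    have hemb : MeasurableEmbedding fun x : Group m => x + c :=
      (MeasurableEquiv.addRight c).measurableEmbedding
    rw [coeff, ← integral_mul_const,
      ← hmp.integral_comp hemb fun x => g x * conj (psi m n x)]
    refine integral_congr_ae (Eventually.of_forall fun x => ?_)
    simp only [hgc, psi_add hm, map_mul]
    ring
  by_contra h
  have : conj (psi m n c) = 1 := by
    have := mul_left_cancel₀ h (hinv.symm.trans (mul_one _).symm)
    exact this
  exact hψc (by simpa using congrArg conj this)

theorem partialSum_eq_self {k : ℕ} {g : Group m → ℂ} (hgi : Integrable g (haar m))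
    (hg : ∀ x, ∀ y ∈ near k k x, g y = g x) {n : ℕ} (hn : M m k ≤ n) (x : Group m) :
    partialSum m g n x = g x := by
  have := isProbabilityMeasure_haar hm
  have h1 : partialSum m g n x = partialSum m g (M m k) x :=
    (Finset.sum_subset (Finset.range_mono hn) fun j _ hj => by
      rw [coeff_eq_zero hm hg (by simpa using hj), zero_mul]).symm
  have h2 : ∀ y, g y * dirichletKernel m (ratio x y) (M m k) =
      (near k k x).indicator (fun _ => M m k * g x) y := fun y => by
    rw [dirichletKernel_M hm (ratio_pow hm x y), nearOne_ratio hm]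
    by_cases hy : y ∈ near k k x
    · simp [hy, hg x y hy, mul_comm]
    · simp [hy]
  have h3 : (haar m).real (near k k x) * M m k = 1 := by
    have := congrArg ENNReal.toReal (haar_cylinder_mul hm k x)
    simpa [Measure.real] using this
  rw [h1, partialSum_eq_integral hm hgi]
  simp_rw [h2]
  rw [integral_indicator_const _ (measurableSet_near k k x), Complex.real_smul, ← mul_assoc]
  rw [show ((haar m).real (near k k x) : ℂ) * M m k = 1 by exact_mod_cast h3, one_mul]

/-- Functions constant on the cylinders of some rank are dense in `L¹`, by Lévy's upward theorem. -/
theorem exists_locallyConstant_lintegral_sub_le {f : Group m → ℂ} (hf : Integrable f (haar m))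
    {ε : ℝ≥0∞} (hε : ε ≠ 0) :
    ∃ (k : ℕ) (g : Group m → ℂ), Measurable g ∧ Integrable g (haar m) ∧
      (∀ x, ∀ y ∈ near k k x, g y = g x) ∧ ∫⁻ x, ‖f x - g x‖ₑ ∂haar m ≤ ε := by
  have := isProbabilityMeasure_haar hm
  set ℱ : Filtration ℕ (MeasurableSpace.pi : MeasurableSpace (Group m)) := Filtration.piLE
  have hsup : (MeasurableSpace.pi : MeasurableSpace (Group m)) ≤ ⨆ n, ℱ n := by
    refine iSup_le fun i => le_trans ?_ (le_iSup _ i)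
    rintro s ⟨t, ht, rfl⟩
    exact ⟨_, measurable_pi_apply (⟨i, Set.mem_Iic.2 le_rfl⟩ : Set.Iic i) ht, rfl⟩
  have hlim : ∀ h : Group m → ℝ, Integrable h (haar m) → ∀ᶠ n in atTop,
      eLpNorm ((haar m)[h|ℱ n] - h) 1 (haar m) ≤ ε / 2 := fun h hh => by
    obtain ⟨h', hh', hae⟩ := hh.1
    have hint : Integrable h' (haar m) := hh.congr hae
    have hten := hint.tendsto_eLpNorm_condExp (ℱ := ℱ) (hh'.mono hsup)
    refine (hten.eventually_le_const (ENNReal.half_pos hε)).mono fun n hn => ?_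
    refine le_trans (le_of_eq (eLpNorm_congr_ae ?_)) hn
    exact (condExp_congr_ae hae).sub hae
  obtain ⟨n, hre, him⟩ := ((hlim _ hf.re).and (hlim _ hf.im)).exists
  set gr := (haar m)[fun x => RCLike.re (f x)|ℱ n] with hgr
  set gi := (haar m)[fun x => RCLike.im (f x)|ℱ n] with hgi
  have hgrm : StronglyMeasurable[ℱ n] gr := stronglyMeasurable_condExp
  have hgim : StronglyMeasurable[ℱ n] gi := stronglyMeasurable_condExp
  have hrm : Measurable gr := (hgrm.mono (ℱ.le n)).measurable
  have him' : Measurable gi := (hgim.mono (ℱ.le n)).measurable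
  have hdep : ∀ h : Group m → ℝ, StronglyMeasurable[ℱ n] h →
      ∀ x, ∀ y ∈ near (n + 1) (n + 1) x, h y = h x := fun h hh x y hy =>
    hh.dependsOn_of_piLE fun i hi => hy i (Nat.lt_succ_of_le hi) (by
      have : i ≤ n := hi
      omega)
  refine ⟨n + 1, fun x => (gr x : ℂ) + gi x * Complex.I, by fun_prop, ?_, ?_, ?_⟩
  · exact integrable_condExp.ofReal.add (integrable_condExp.ofReal.mul_const _)
  · intro x y hy
    simp only [hdep gr hgrm x y hy, hdep gi hgim x y hy]
  · rw [eLpNorm_one_eq_lintegral_enorm] at hre him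
    have hmeas : AEMeasurable (fun x => ‖(gr - fun x => RCLike.re (f x)) x‖ₑ) (haar m) :=
      (hrm.aemeasurable.sub hf.re.1.aemeasurable).enorm
    calc _ ≤ ∫⁻ x, (‖(gr - fun x => RCLike.re (f x)) x‖ₑ +
          ‖(gi - fun x => RCLike.im (f x)) x‖ₑ) ∂haar m := by
          refine lintegral_mono fun x => ?_
          have : f x - (gr x + gi x * Complex.I) =
              -(((gr x - (f x).re : ℝ) : ℂ) + ((gi x - (f x).im : ℝ) : ℂ) * Complex.I) := by
            conv_lhs => rw [← Complex.re_add_im (f x)]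
            push_cast
            ring
          rw [this, enorm_neg]
          refine (enorm_add_le _ _).trans (le_of_eq ?_)
          rw [enorm_mul, ← ofReal_norm Complex.I, Complex.norm_I, ENNReal.ofReal_one, mul_one,
            ← ofReal_norm, ← ofReal_norm, Complex.norm_real, Complex.norm_real, ofReal_norm,
            ofReal_norm]
          rfl
      _ = _ := lintegral_add_left' hmeas _
      _ ≤ ε / 2 + ε / 2 := add_le_add hre him
      _ = ε := ENNReal.add_halves ε

end LocallyConstant

/-! ### Almost everywhere convergence of the Fejér means -/

section Fejer

variable {m : ℕ → ℕ} (hm : ∀ k, 2 ≤ m k)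

include hm

theorem ae_eventually_norm_fejerMean_sub_le {b : ℕ} (hb : ∀ k, m k ≤ b) {f : Group m → ℂ}
    (hfm : Measurable f) (hf : Integrable f (haar m)) {c : ℝ≥0} (hc : c ≠ 0) :
    ∀ᵐ x ∂haar m, ∀ᶠ n : ℕ in atTop,
      ‖(∑ k ∈ Finset.range n, partialSum m f (k + 1) x) / (n : ℂ) - f x‖ ≤
        (6 * b ^ 2 * (2 * b + 1) + 2) * c := by
  -- The exceptional set does not depend on the approximant `g`, so its measure is bounded by a
  -- multiple of `‖f - g‖₁ ≤ ε` for every `ε`.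
  have hbound : ∀ ε : ℝ≥0∞, ε ≠ 0 → c * haar m {x | ¬ ∀ᶠ n : ℕ in atTop,
      ‖(∑ k ∈ Finset.range n, partialSum m f (k + 1) x) / (n : ℂ) - f x‖ ≤
        (6 * b ^ 2 * (2 * b + 1) + 2) * c} ≤ (2 * b + 1) * ε + ε := by
    intro ε hε
    obtain ⟨k, g, hgm, hgi, hg, hfg⟩ := exists_locallyConstant_lintegral_sub_le hm hf hε
    have hsub : {x | ¬ ∀ᶠ n : ℕ in atTop,
        ‖(∑ k ∈ Finset.range n, partialSum m f (k + 1) x) / (n : ℂ) - f x‖ ≤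
          (6 * b ^ 2 * (2 * b + 1) + 2) * c} ⊆
        {x | ∃ l, (2 * b + 1) * (c : ℝ≥0∞) < nearOperator l (fun y => ‖(f - g) y‖ₑ) x} ∪
          {x | (c : ℝ≥0∞) ≤ ‖f x - g x‖ₑ} := by
      intro x hx
      by_contra hcon
      rw [Set.mem_union, not_or] at hcon
      simp only [Set.mem_ofPred_eq, not_exists, not_lt, not_le] at hcon
      refine hx ?_
      have h1 := norm_sum_partialSum_le hm hb (hfm.sub hgm) (hf.sub hgi) (x := x)
        (K := (2 * b + 1) * c) (by exact_mod_cast hcon.1)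
      have h2 : ‖f x - g x‖ ≤ c := by
        have := hcon.2.le
        rw [enorm_le_coe] at this
        exact_mod_cast this
      have h3 : Tendsto (fun n : ℕ => (∑ k ∈ Finset.range n, partialSum m g (k + 1) x) / (n : ℂ))
          atTop (𝓝 (g x)) := by
        have h : Tendsto (fun n => partialSum m g (n + 1) x) atTop (𝓝 (g x)) :=
          tendsto_const_nhds.congr' <| (eventually_ge_atTop (M m k)).mono fun n hn =>
            (partialSum_eq_self hm hgi hg (by omega) x).symm
        refine h.cesaro_smul.congr fun n => ?_
        rw [Complex.real_smul, div_eq_inv_mul]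
        push_cast
        rfl
      have h4 : ∀ᶠ n : ℕ in atTop,
          ‖(∑ k ∈ Finset.range n, partialSum m g (k + 1) x) / (n : ℂ) - g x‖ ≤ c := by
        have := (tendsto_iff_norm_sub_tendsto_zero.1 h3).eventually_le_const
          (show (0 : ℝ) < c by exact_mod_cast pos_iff_ne_zero.2 hc)
        exact this
      filter_upwards [h4, eventually_gt_atTop 0] with n hn hn0
      have hn0' : (0 : ℝ) < n := by exact_mod_cast hn0
      have h5 : ‖(∑ k ∈ Finset.range n, partialSum m (f - g) (k + 1) x) / (n : ℂ)‖ ≤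
          6 * b ^ 2 * (2 * b + 1) * c := by
        rw [norm_div, Complex.norm_natCast, div_le_iff₀ hn0']
        refine (h1 n).trans_eq ?_
        push_cast
        ring
      have h6 : (∑ k ∈ Finset.range n, partialSum m f (k + 1) x) / (n : ℂ) - f x =
          (∑ k ∈ Finset.range n, partialSum m (f - g) (k + 1) x) / (n : ℂ) +
          ((∑ k ∈ Finset.range n, partialSum m g (k + 1) x) / (n : ℂ) - g x) +
          -(f x - g x) := by
        simp_rw [partialSum_sub hm hf hgi, Finset.sum_sub_distrib]
        ring
      rw [h6]
      refine norm_add₃_le.trans ?_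
      rw [norm_neg]
      linarith
    have hw := mul_haar_exists_nearOperator_gt_le hm hb c (hfm.sub hgm).enorm
    have hmk := mul_meas_ge_le_lintegral (μ := haar m) (hfm.sub hgm).enorm c
    calc _ ≤ (c : ℝ≥0∞) * (haar m _ + haar m _) :=
          mul_le_mul_right ((measure_mono hsub).trans (measure_union_le _ _)) _
      _ ≤ (2 * b + 1) * ∫⁻ x, ‖f x - g x‖ₑ ∂haar m + ∫⁻ x, ‖f x - g x‖ₑ ∂haar m := by
          rw [mul_add]
          exact add_le_add hw hmk
      _ ≤ _ := by gcongr
  have hzero : (c : ℝ≥0∞) * haar m {x | ¬ ∀ᶠ n : ℕ in atTop,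
      ‖(∑ k ∈ Finset.range n, partialSum m f (k + 1) x) / (n : ℂ) - f x‖ ≤
        (6 * b ^ 2 * (2 * b + 1) + 2) * c} = 0 := by
    have hten : Tendsto (fun ε : ℝ≥0∞ => (2 * b + 1) * ε + ε) (𝓝[>] 0) (𝓝 0) := by
      have h : Tendsto (fun ε : ℝ≥0∞ => (2 * b + 1) * ε + ε) (𝓝 0) (𝓝 ((2 * b + 1) * 0 + 0)) :=
        (ENNReal.Tendsto.const_mul tendsto_id (Or.inr (by finiteness))).add tendsto_id
      rw [mul_zero, add_zero] at h
      exact h.mono_left nhdsWithin_le_nhds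
    refine le_antisymm (ge_of_tendsto hten ?_) zero_le
    filter_upwards [self_mem_nhdsWithin] with ε hε
    exact hbound ε (ne_of_gt hε)
  exact (mul_eq_zero.1 hzero).resolve_left (by exact_mod_cast hc)

theorem ae_tendsto_fejerMean_of_measurable {b : ℕ} (hb : ∀ k, m k ≤ b) {f : Group m → ℂ}
    (hfm : Measurable f) (hf : Integrable f (haar m)) :
    ∀ᵐ x ∂haar m, Tendsto
      (fun n : ℕ => (∑ k ∈ Finset.range n, partialSum m f (k + 1) x) / (n : ℂ)) atTop
      (𝓝 (f x)) := by
  have h : ∀ᵐ x ∂haar m, ∀ N : ℕ, ∀ᶠ n : ℕ in atTop,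
      ‖(∑ k ∈ Finset.range n, partialSum m f (k + 1) x) / (n : ℂ) - f x‖ ≤
        (6 * b ^ 2 * (2 * b + 1) + 2) * (((N : ℝ≥0) + 1)⁻¹ : ℝ≥0) :=
    ae_all_iff.2 fun N => ae_eventually_norm_fejerMean_sub_le hm hb hfm hf (by positivity)
  filter_upwards [h] with x hx
  rw [tendsto_iff_norm_sub_tendsto_zero]
  have hlim : Tendsto (fun N : ℕ => (6 * (b : ℝ) ^ 2 * (2 * b + 1) + 2) *
      ((((N : ℝ≥0) + 1)⁻¹ : ℝ≥0) : ℝ)) atTop (𝓝 0) := by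
    have := (tendsto_one_div_add_atTop_nhds_zero_nat (𝕜 := ℝ)).const_mul
      (6 * (b : ℝ) ^ 2 * (2 * b + 1) + 2)
    rw [mul_zero] at this
    refine this.congr fun N => ?_
    push_cast
    rw [one_div]
  refine tendsto_order.2 ⟨fun a ha => Eventually.of_forall fun n => ha.trans_le (norm_nonneg _),
    fun a ha => ?_⟩
  obtain ⟨N, hN⟩ := (hlim.eventually_lt_const ha).exists
  exact (hx N).mono fun n hn => hn.trans_lt hN

/-- The Fejér means of an integrable function converge to it almost everywhere. -/
theorem ae_tendsto_fejerMean {b : ℕ} (hb : ∀ k, m k ≤ b) {f : Group m → ℂ}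
    (hf : Integrable f (haar m)) :
    ∀ᵐ x ∂haar m, Tendsto
      (fun n : ℕ => (∑ k ∈ Finset.range n, partialSum m f (k + 1) x) / (n : ℂ)) atTop
      (𝓝 (f x)) := by
  obtain ⟨f', hf', hae⟩ := hf.1
  have hcoeff : ∀ n, coeff m f n = coeff m f' n := fun n =>
    integral_congr_ae (hae.mono fun x hx => by simp only [hx])
  filter_upwards [hae, ae_tendsto_fejerMean_of_measurable hm hb hf'.measurable (hf.congr hae)]
    with x hx h
  simpa only [partialSum, hcoeff, hx] using h

end Fejer

end Vilenkin

theorem mainTheorem2 (m : ℕ → ℕ) (hm : ∀ k, 2 ≤ m k) (hbdd : BddAbove (Set.range m))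
    (p : ℝ≥0∞) (hp : 1 ≤ p) (f : Vilenkin.Group m → ℂ) (hf : MemLp f p (Vilenkin.haar m)) :
    (∀ᵐ x ∂(Vilenkin.haar m),
      Tendsto (fun n => Vilenkin.rieszMean m f n x) atTop (𝓝 (f x))) ∧
    (∀ α : ℝ, 0 < α → α < 1 → ∀ᵐ x ∂(Vilenkin.haar m),
      Tendsto (fun n => Vilenkin.inverseCesaroMean m α f n x) atTop (𝓝 (f x))) ∧
    (∀ α : ℝ, 0 < α → α < 1 → ∀ᵐ x ∂(Vilenkin.haar m),
      Tendsto (fun n => Vilenkin.powerMean m α f n x) atTop (𝓝 (f x))) ∧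
    (∀ α : ℝ, 0 < α → ∀ᵐ x ∂(Vilenkin.haar m),
      Tendsto (fun n => Vilenkin.logMean m α f n x) atTop (𝓝 (f x))) := by
  have := Vilenkin.isProbabilityMeasure_haar hm
  obtain ⟨b, hb⟩ := hbdd
  have h := Vilenkin.ae_tendsto_fejerMean hm (fun k => hb (Set.mem_range_self k))
    (hf.integrable hp)
  refine ⟨?_, fun α h0 h1 => ?_, fun α h0 h1 => ?_, fun α h0 => ?_⟩
  · exact h.mono fun x hx => Vilenkin.tendsto_riesz (S := fun k => Vilenkin.partialSum m f k x) hx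
  · exact h.mono fun x hx =>
      Vilenkin.tendsto_inverseCesaro (S := fun k => Vilenkin.partialSum m f k x) h0 h1 hx
  · exact h.mono fun x hx =>
      Vilenkin.tendsto_power (S := fun k => Vilenkin.partialSum m f k x) h0 h1 hx
  · exact h.mono fun x hx =>
      Vilenkin.tendsto_log (S := fun k => Vilenkin.partialSum m f k x) h0 hx
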